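/- Let $k$ be a field of characteristic $\neq 2$, let $m,n,d\ge 0$, and let $M=k^{m|n}$ be the superspace with basis $Z_1,\dots,Z_{m+n}$, where $Z_a$ is even for $a\le m$ and odd for $a>m$; $\Pi M$ is $M$ with reversed parity. For a superspace with homogeneous basis $(Z_a)$ and a word $\boldsymbol i=(i_1,\dots,i_d)$ put $Z^{\boldsymbol i}=Z_{i_1}\otimes\dots\otimes Z_{i_d}$, and let $\mathfrak S_d$ act on the $d$-th tensor power from the right by $$Z^{\boldsymbol i}.\sigma=\Big(\prod_{s<t,\ \sigma^{-1}s>\sigma^{-1}t}(-1)^{|Z_{i_s}||Z_{i_t}|}\Big)Z^{\boldsymbol i.\sigma},\qquad (\boldsymbol i.\sigma)_r=i_{\sigma r}.$$ **The algebra.** Let $S(m|n,d)=\operatorname{End}_{k\mathfrak S_d}(M^{\otimes d})$ be the Schur superalgebra. Let $E_{a,b}$ be the matrix units of $\operatorname{End}(M)$. A pair of words $(\boldsymbol i,\boldsymbol j)$ is strict if $(i_a,j_a)\ne(i_b,j_b)$ whenever $a\neq b$ and $E_{i_a,j_a},E_{i_b,j_b}$ are odd. For a strict pair let $$E^{(\boldsymbol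 i,\boldsymbol j)}=\sum_{(\boldsymbol s,\boldsymbol t)}\pm\,E_{s_1,t_1}\otimes\dots\otimes E_{s_d,t_d}\in S(m|n,d),$$ the sum over the distinct pairs $(\boldsymbol s,\boldsymbol t)=(\boldsymbol i.\tau,\boldsymbol j.\tau)$, $\tau\in\mathfrak S_d$, with sign $\prod_{a<b,\ \tau^{-1}a>\tau^{-1}b}(-1)^{|E_{i_a,j_a}||E_{i_b,j_b}|}$, where tensors of endomorphisms act on $M^{\otimes d}$ by the rule of signs. Let $N(m|n,d)\subset S(m|n,d)$ be the linear span of the $E^{(\boldsymbol i,\boldsymbol j)}$ over the strict pairs such that $\boldsymbol i.\sigma\prec\boldsymbol j.\sigma$ in the lexicographic order for all $\sigma\in\mathfrak S_d$; equivalently, $i_r\le j_r$ for all $r$ and $\boldsymbol i\ne\boldsymbol j$. **The module.** Let $\lambda$ be a partition of $d$, with conjugate $\lambda'$, and let $l(\lambda')$ be the number of nonzero parts of $\lambda'$. Let $\Gamma_\Pi^{\lambda}M=\Gamma^{\lambda_1}(\Pi M)\otimes\Gamma^{\lambda_2}(\Pi M)\otimes\cdots\subset(\Pi M)^{\otimes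 d}$ be the space of invariants of the Young subgroup $\mathfrak S_\lambda=\mathfrak S_{\lambda_1}\times\mathfrak S_{\lambda_2}\times\cdots$, and let $S^{\lambda'}M=S^{\lambda'_1}M\otimes S^{\lambda'_2}M\otimes\cdots$ be the coinvariants of $\mathfrak S_{\lambda'}$ in $M^{\otimes d}$, a quotient $S(m|n,d)$-module of $M^{\otimes d}$. The Schur supermodule $\widehat S_{\lambda'}(M)\subset S^{\lambda'}M$ is the $S(m|n,d)$-submodule which is the image of the composite $$\hat\theta_{\lambda'}:\ \Gamma_\Pi^{\lambda}M\hookrightarrow(\Pi M)^{\otimes d}\xrightarrow{\,1^{\otimes d}\,}M^{\otimes d}\xrightarrow{\,\cdot\,\sigma_{\lambda'}\,}M^{\otimes d}\twoheadrightarrow S^{\lambda'}M,$$ where $1:\Pi M\to M$ is the odd identity map (and $1^{\otimes d}$ acts by the rule of signs), and $\sigma_{\lambda'}$ sends the position of a cell in the row-by-row numbering of the diagram of $\lambda'$ to its position in the column-by-column numbering. Suppose that $l(\lambda')\le m$. Let $\mathfrak c_\lambda$ be the canonical tableau of shape $\lambda$, $\mathfrak c_\lambda(i,j)=j$, with reading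 word $\boldsymbol c$ (rows from left to right, and from top to bottom). Write $Z_\Pi^{(\mathfrak c_\lambda)}=\sum_{\sigma\in\mathfrak S_\lambda}Z_\Pi^{\boldsymbol c}.\sigma\in\Gamma_\Pi^\lambda M$, where $Z_\Pi^{\boldsymbol c}$ is the basis tensor of $(\Pi M)^{\otimes d}$, and write $Z_\Pi^{(\mathfrak c_\lambda)}$ also for the image of this element in $\widehat S_{\lambda'}(M)$. **Theorem.** Let $\lambda$ be a partition of $d$ with $l(\lambda')\le m$. A linear subspace (graded or not) of $\widehat S_{\lambda'}(M)$ is called an $N(m|n,d)$-submodule if it is stable under all elements of $N(m|n,d)$. Then: (i) every nonzero $N(m|n,d)$-submodule of $\widehat S_{\lambda'}(M)$ contains $Z_\Pi^{(\mathfrak c_\lambda)}$; (ii) the space of $N(m|n,d)$-invariants $\{v\in\widehat S_{\lambda'}(M): xv=0\text{ for all }x\in N(m|n,d)\}$ is the span of $Z_\Pi^{(\mathfrak c_\lambda)}$; (iii) $\widehat S_{\lambda'}(M)$ is $N(m|n,d)$-indecomposable: it is nonzero, and is not the direct sum of two nonzero $N(m|n,d)$-submodules. -/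

import Mathlib

open scoped TensorProduct

noncomputable section

namespace SchurSuper

/-! ### Signs

Parities and exponents of `-1` live in `ZMod 2`. -/

/-- The sign `(-1)^e`. -/
def sgn (k : Type*) [Field k] (e : ZMod 2) : k := (-1) ^ e.val

theorem sgn_add (k : Type*) [Field k] (a b : ZMod 2) : sgn k (a + b) = sgn k a * sgn k b := by
  have key : ∀ a b : ZMod 2, (a = 0 ∨ a = 1) ∧ (b = 0 ∨ b = 1) := by decide
  rcases key a b with ⟨rfl | rfl, rfl | rfl⟩ <;> simp [sgn, ZMod.val_one, show (1 : ZMod 2) + 1 = 0 from rfl]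

theorem sgn_mul_self (k : Type*) [Field k] (a : ZMod 2) : sgn k a * sgn k a = 1 := by
  rw [← sgn_add, CharTwo.add_self_eq_zero]; simp [sgn]

/-- The exponent of the sign `∏ (-1)^(ε_s ε_t)`, over all `s < t` with `σ⁻¹ s > σ⁻¹ t`. -/
def invSum {d : ℕ} (ε : Fin d → ZMod 2) (σ : Equiv.Perm (Fin d)) : ZMod 2 :=
  ∑ s, ∑ t, if s < t ∧ σ.symm t < σ.symm s then ε s * ε t else 0

/-- The exponent of the sign in the rule of signs
`(f_1 ⊗ ⋯ ⊗ f_d) (v_1 ⊗ ⋯ ⊗ v_d) = ± f_1 v_1 ⊗ ⋯ ⊗ f_d v_d`, for maps `f_s` of parity `ε_s` and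
vectors `v_s` of parity `δ_s`: each `f_t` moves past every `v_s` with `s < t`. -/
def ruleOfSigns {d : ℕ} (ε δ : Fin d → ZMod 2) : ZMod 2 :=
  ∑ s, ∑ t, if s < t then ε t * δ s else 0

theorem sum_fold {d : ℕ} (H : Fin d → Fin d → ZMod 2) (h0 : ∀ a, H a a = 0) :
    ∑ a, ∑ b, H a b = ∑ a, ∑ b, if a < b then H a b + H b a else 0 := by
  have h1 : ∑ a, ∑ b, (if a < b then H a b + H b a else 0) =
      ∑ a, ∑ b, (if a < b then H a b else 0) + ∑ a, ∑ b, (if b < a then H a b else 0) := by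
    rw [Finset.sum_comm (f := fun a b => if b < a then H a b else 0)]
    simp only [← Finset.sum_add_distrib]
    refine Finset.sum_congr rfl fun a _ => Finset.sum_congr rfl fun b _ => ?_
    split_ifs <;> simp
  rw [h1]
  simp only [← Finset.sum_add_distrib]
  refine Finset.sum_congr rfl fun a _ => Finset.sum_congr rfl fun b _ => ?_
  rcases lt_trichotomy a b with h | h | h
  · simp [h, h.not_gt]
  · subst h; simp [h0]
  · simp [h, h.not_gt]

theorem sum_reindex {d : ℕ} (σ : Equiv.Perm (Fin d)) (F : Fin d → Fin d → ZMod 2) :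
    ∑ s, ∑ t, F s t = ∑ a, ∑ b, F (σ.symm a) (σ.symm b) := by
  rw [← Equiv.sum_comp σ.symm]
  refine Finset.sum_congr rfl fun a _ => ?_
  rw [← Equiv.sum_comp σ.symm]

theorem sum_reindex_fold {d : ℕ} (σ : Equiv.Perm (Fin d)) (F : Fin d → Fin d → ZMod 2)
    (h0 : ∀ a, F a a = 0) :
    ∑ s, ∑ t, F s t = ∑ a, ∑ b, if a < b then
      F (σ.symm a) (σ.symm b) + F (σ.symm b) (σ.symm a) else 0 := by
  rw [sum_reindex σ F]
  exact sum_fold (fun a b => F (σ.symm a) (σ.symm b)) fun a => h0 _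

theorem invSum_mul {d : ℕ} (ε : Fin d → ZMod 2) (σ τ : Equiv.Perm (Fin d)) :
    invSum ε (σ * τ) = invSum ε σ + invSum (ε ∘ σ) τ := by
  unfold invSum
  rw [sum_reindex_fold σ
    (fun s t => if s < t ∧ τ.symm t < τ.symm s then (ε ∘ σ) s * (ε ∘ σ) t else 0)]
  · simp only [← Finset.sum_add_distrib]
    refine Finset.sum_congr rfl fun a _ => Finset.sum_congr rfl fun b _ => ?_
    by_cases hab : a < b
    swap
    · simp [hab]
    have e1 : ∀ c, (σ * τ).symm c = τ.symm (σ.symm c) := fun c => rfl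
    have hx : σ.symm a ≠ σ.symm b := fun h => hab.ne (σ.symm.injective h)
    have hu : τ.symm (σ.symm a) ≠ τ.symm (σ.symm b) := fun h => hx (τ.symm.injective h)
    simp only [e1, Function.comp, Equiv.apply_symm_apply, hab, true_and, if_true]
    rcases lt_or_gt_of_ne hx with h | h <;> rcases lt_or_gt_of_ne hu with h' | h' <;>
      simp [h, h', h.not_gt, h'.not_gt, mul_comm (ε b) (ε a), CharTwo.add_self_eq_zero]
  · intro a; simp

theorem invSum_add {d : ℕ} (P Q : Fin d → ZMod 2) (σ : Equiv.Perm (Fin d)) :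
    invSum (P + Q) σ =
      invSum P σ + invSum Q σ + ruleOfSigns P Q + ruleOfSigns (P ∘ σ) (Q ∘ σ) := by
  unfold invSum ruleOfSigns
  rw [sum_reindex_fold σ (fun s t => if s < t then (P ∘ σ) t * (Q ∘ σ) s else 0)]
  · simp only [← Finset.sum_add_distrib]
    refine Finset.sum_congr rfl fun a _ => Finset.sum_congr rfl fun b _ => ?_
    by_cases hab : a < b
    swap
    · simp [hab]
    have hx : σ.symm a ≠ σ.symm b := fun h => hab.ne (σ.symm.injective h)
    simp only [Function.comp, Equiv.apply_symm_apply, hab, true_and, if_true, Pi.add_apply]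
    have h2 : (2 : ZMod 2) = 0 := rfl
    rcases lt_or_gt_of_ne hx with h | h
    · simp only [h, h.not_gt, if_true, if_false]
      linear_combination (-(P b * Q a)) * h2
    · simp only [h, h.not_gt, if_true, if_false]
      ring
  · intro a; simp

/-- If the positions of odd parity carry pairwise distinct labels, then the sign of a permutation
only depends on the permuted sequence of labels. -/
theorem invSum_eq_of_comp_eq {d : ℕ} {α : Type*} (ε : Fin d → ZMod 2) (f : Fin d → α)
    (hf : ∀ a b, a ≠ b → ε a = 1 → ε b = 1 → f a ≠ f b) (hε : ∀ a b, f a = f b → ε a = ε b)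
    (σ τ : Equiv.Perm (Fin d)) (h : f ∘ σ = f ∘ τ) : invSum ε σ = invSum ε τ := by
  have key : ∀ a, ε a = 1 → σ.symm a = τ.symm a := by
    intro a ha
    have h1 : f a = f (τ (σ.symm a)) := by
      have := congrFun h (σ.symm a)
      simpa using this
    by_contra hne
    have hne' : a ≠ τ (σ.symm a) := fun e => hne (τ.eq_symm_apply.mpr e.symm)
    exact hf _ _ hne' ha ((hε _ _ h1) ▸ ha) h1
  have z : ∀ x : ZMod 2, x = 0 ∨ x = 1 := by decide
  unfold invSum
  refine Finset.sum_congr rfl fun a _ => Finset.sum_congr rfl fun b _ => ?_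
  rcases z (ε a) with ha | ha
  · simp [ha]
  rcases z (ε b) with hb | hb
  · simp [hb]
  rw [key a ha, key b hb]

/-! ### Tensor powers of superspaces

A finite dimensional superspace with a homogeneous basis is `Fin N → k` with its standard basis
`Z_1, …, Z_N` and a parity function `p : Fin N → ZMod 2`. -/

/-- The parity of the basis vectors `X_1 < ⋯ < X_m < Y_1 < ⋯ < Y_n` of `M = k^{m|n}`. -/
def parity (m n : ℕ) (a : Fin (m + n)) : ZMod 2 := if (a : ℕ) < m then 0 else 1

/-- The parity of the same basis vectors in the superspace `ΠM`. -/
def parityPi (m n : ℕ) (a : Fin (m + n)) : ZMod 2 := 1 + parity m n a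

/-- The underlying vector space of the `d`-th tensor power of `k^N`. -/
def TensorPow (k : Type*) [Field k] (N d : ℕ) : Type _ := ⨂[k] _ : Fin d, (Fin N → k)

instance (k : Type*) [Field k] (N d : ℕ) : AddCommGroup (TensorPow k N d) :=
  inferInstanceAs (AddCommGroup (⨂[k] _ : Fin d, (Fin N → k)))

instance (k : Type*) [Field k] (N d : ℕ) : Module k (TensorPow k N d) :=
  inferInstanceAs (Module k (⨂[k] _ : Fin d, (Fin N → k)))

/-- The basis `Z^i = Z_{i_1} ⊗ ⋯ ⊗ Z_{i_d}` of the tensor power. -/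
def Zw (k : Type*) [Field k] (N d : ℕ) :
    Module.Basis (Fin d → Fin N) k (TensorPow k N d) :=
  Basis.piTensorProduct fun _ => Pi.basisFun k (Fin N)

/-- The right action of a permutation on the tensor power of a superspace,
`Z^i . σ = sgn(|i|, σ) Z^{i.σ}` where `i.σ = i ∘ σ`. -/
def superPerm (k : Type*) [Field k] {N d : ℕ} (p : Fin N → ZMod 2) (σ : Equiv.Perm (Fin d)) :
    Module.End k (TensorPow k N d) :=
  (Zw k N d).constr k fun i => sgn k (invSum (p ∘ i) σ) • Zw k N d (i ∘ σ)

theorem superPerm_Zw (k : Type*) [Field k] {N d : ℕ} (p : Fin N → ZMod 2)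
    (σ : Equiv.Perm (Fin d)) (i : Fin d → Fin N) :
    superPerm k p σ (Zw k N d i) = sgn k (invSum (p ∘ i) σ) • Zw k N d (i ∘ σ) := by
  simp [superPerm]

/-! ### The Schur superalgebra -/

/-- The Schur superalgebra `S(m|n,d) = End_{k𝔖_d}(M^{⊗d})`, where `M = k^{m|n}`. -/
def schurAlgebra (k : Type*) [Field k] (m n d : ℕ) :
    Subalgebra k (Module.End k (TensorPow k (m + n) d)) :=
  Subalgebra.centralizer k (Set.range (superPerm k (d := d) (parity m n)))

/-- The endomorphism `E_{i_1,j_1} ⊗ ⋯ ⊗ E_{i_d,j_d}` of `M^{⊗d}`, where `E_{a,b}` are the matrix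
units; it acts by the rule of signs. -/
def tensorE (k : Type*) [Field k] (m n : ℕ) {d : ℕ} (i j : Fin d → Fin (m + n)) :
    Module.End k (TensorPow k (m + n) d) :=
  (Zw k (m + n) d).constr k fun l =>
    if l = j then
      sgn k (ruleOfSigns (parity m n ∘ i + parity m n ∘ j) (parity m n ∘ l)) • Zw k (m + n) d i
    else 0

/-- A pair of words is strict if no odd matrix unit occurs twice in `E_{i_1,j_1}, …, E_{i_d,j_d}`. -/
def IsStrict (m n : ℕ) {d : ℕ} (i j : Fin d → Fin (m + n)) : Prop :=
  ∀ a b, a ≠ b → parity m n (i a) + parity m n (j a) = 1 →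
    parity m n (i b) + parity m n (j b) = 1 → (i a, j a) ≠ (i b, j b)

open Classical in
/-- The coefficient of `E^{s,t}` in `E^{(i,j)}`: it is `sgn(|i| + |j|, τ)` if
`(s, t) = (i.τ, j.τ)` for a permutation `τ`, and `0` if there is no such `τ`.
For strict pairs it does not depend on the choice of `τ`. -/
def orbitCoeff (k : Type*) [Field k] (m n : ℕ) {d : ℕ} (i j s t : Fin d → Fin (m + n)) : k :=
  if h : ∃ τ : Equiv.Perm (Fin d), i ∘ τ = s ∧ j ∘ τ = t then
    sgn k (invSum (parity m n ∘ i + parity m n ∘ j) h.choose)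
  else 0

/-- The element `E^{(i,j)} = ∑ ± E^{s,t}`, the sum over the orbit of the pair `(i,j)`. -/
def dividedE (k : Type*) [Field k] (m n : ℕ) {d : ℕ} (i j : Fin d → Fin (m + n)) :
    Module.End k (TensorPow k (m + n) d) :=
  ∑ s, ∑ t, orbitCoeff k m n i j s t • tensorE k m n s t

theorem orbitCoeff_eq (k : Type*) [Field k] (m n : ℕ) {d : ℕ} {i j : Fin d → Fin (m + n)}
    (hij : IsStrict m n i j) (τ : Equiv.Perm (Fin d)) :
    orbitCoeff k m n i j (i ∘ τ) (j ∘ τ) =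
      sgn k (invSum (parity m n ∘ i + parity m n ∘ j) τ) := by
  have h : ∃ τ' : Equiv.Perm (Fin d), i ∘ τ' = i ∘ τ ∧ j ∘ τ' = j ∘ τ := ⟨τ, rfl, rfl⟩
  rw [orbitCoeff, dif_pos h]
  congr 1
  refine invSum_eq_of_comp_eq _ (fun a => (i a, j a)) (fun a b hab ha hb => hij a b hab ha hb)
    ?_ _ _ ?_
  · intro a b hab
    simp only [Prod.mk.injEq] at hab
    simp [hab.1, hab.2]
  · funext a
    exact Prod.ext (congrFun h.choose_spec.1 a) (congrFun h.choose_spec.2 a)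

theorem orbitCoeff_comp (k : Type*) [Field k] (m n : ℕ) {d : ℕ} {i j : Fin d → Fin (m + n)}
    (hij : IsStrict m n i j) (s t : Fin d → Fin (m + n)) (σ : Equiv.Perm (Fin d)) :
    orbitCoeff k m n i j (s ∘ σ) (t ∘ σ) =
      sgn k (invSum (parity m n ∘ s + parity m n ∘ t) σ) * orbitCoeff k m n i j s t := by
  by_cases h : ∃ τ : Equiv.Perm (Fin d), i ∘ τ = s ∧ j ∘ τ = t
  · obtain ⟨τ, rfl, rfl⟩ := h
    have e : ∀ f : Fin d → Fin (m + n), (f ∘ τ) ∘ σ = f ∘ (τ * σ : Equiv.Perm (Fin d)) :=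
      fun f => rfl
    rw [e i, e j, orbitCoeff_eq k m n hij, orbitCoeff_eq k m n hij, invSum_mul, sgn_add, mul_comm]
    rfl
  · have h' : ¬ ∃ τ : Equiv.Perm (Fin d), i ∘ τ = s ∘ σ ∧ j ∘ τ = t ∘ σ := by
      rintro ⟨τ, h1, h2⟩
      refine h ⟨τ * σ⁻¹, ?_, ?_⟩
      · funext a
        simpa using congrFun h1 (σ⁻¹ a)
      · funext a
        simpa using congrFun h2 (σ⁻¹ a)
    rw [orbitCoeff, dif_neg h', orbitCoeff, dif_neg h, mul_zero]

theorem dividedE_Zw (k : Type*) [Field k] (m n : ℕ) {d : ℕ} (i j l : Fin d → Fin (m + n)) :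
    dividedE k m n i j (Zw k (m + n) d l) =
      ∑ s, (orbitCoeff k m n i j s l *
        sgn k (ruleOfSigns (parity m n ∘ s + parity m n ∘ l) (parity m n ∘ l))) •
          Zw k (m + n) d s := by
  simp only [dividedE, LinearMap.sum_apply, LinearMap.smul_apply, tensorE,
    Module.Basis.constr_basis]
  refine Finset.sum_congr rfl fun s _ => ?_
  rw [Finset.sum_eq_single l]
  · simp [mul_smul]
  · intro t _ ht
    simp [ht.symm]
  · simp

theorem dividedE_mem (k : Type*) [Field k] (m n : ℕ) {d : ℕ} {i j : Fin d → Fin (m + n)}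
    (hij : IsStrict m n i j) : dividedE k m n i j ∈ schurAlgebra k m n d := by
  rw [schurAlgebra, Subalgebra.mem_centralizer_iff]
  rintro _ ⟨σ, rfl⟩
  refine (Zw k (m + n) d).ext fun l => ?_
  rw [Module.End.mul_apply, Module.End.mul_apply, superPerm_Zw, map_smul, dividedE_Zw, dividedE_Zw,
    map_sum, Finset.smul_sum]
  rw [← Equiv.sum_comp (Equiv.arrowCongr σ.symm (Equiv.refl (Fin (m + n))))
    (fun s => sgn k (invSum (parity m n ∘ l) σ) • _)]
  refine Finset.sum_congr rfl fun s _ => ?_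
  have e : (Equiv.arrowCongr σ.symm (Equiv.refl (Fin (m + n)))) s = s ∘ σ := rfl
  rw [e, map_smul, superPerm_Zw, smul_smul, smul_smul, orbitCoeff_comp k m n hij]
  congr 1
  set P : Fin d → ZMod 2 := parity m n ∘ s + parity m n ∘ l with hP
  set Q : Fin d → ZMod 2 := parity m n ∘ l with hQ
  have h1 : parity m n ∘ s = P + Q := by
    funext a
    simp [hP, hQ, add_assoc, CharTwo.add_self_eq_zero]
  have h2 : parity m n ∘ (s ∘ σ) + parity m n ∘ (l ∘ σ) = P ∘ σ := rfl
  have h3 : parity m n ∘ (l ∘ σ) = Q ∘ σ := rfl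
  rw [h2, h3, h1, invSum_add, sgn_add, sgn_add, sgn_add]
  linear_combination (orbitCoeff k m n i j s l * sgn k (invSum P σ) * sgn k (invSum Q σ) *
    sgn k (ruleOfSigns (P ∘ σ) (Q ∘ σ))) * sgn_mul_self k (ruleOfSigns P Q)

/-- `E^{(i,j)}`, for a strict pair `(i,j)`, as an element of the Schur superalgebra. -/
def schurE (k : Type*) [Field k] (m n : ℕ) {d : ℕ} (i j : Fin d → Fin (m + n))
    (hij : IsStrict m n i j) : schurAlgebra k m n d :=
  ⟨dividedE k m n i j, dividedE_mem k m n hij⟩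

/-- `N(m|n,d)`: the span of the elements `E^{(i,j)}`, for strict pairs `(i,j)` with `i ≺ j` in the
lexicographic order. As `E^{(i,j)}` is, up to sign, the same element for all pairs
`(i.σ, j.σ)` of the orbit of `(i,j)`, the condition is imposed on the orbit, that is, on each of
these pairs; it says that `i_r ≤ j_r` for all `r`, and `i ≠ j`. -/
def upperN (k : Type*) [Field k] (m n d : ℕ) : Submodule k (schurAlgebra k m n d) :=
  Submodule.span k {x | ∃ (i j : Fin d → Fin (m + n)) (hij : IsStrict m n i j),
    (∀ σ : Equiv.Perm (Fin d), toLex (i ∘ σ) < toLex (j ∘ σ)) ∧ x = schurE k m n i j hij}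

/-! ### Young diagrams

A partition `λ` of `d` is a Young diagram with `d` cells; its conjugate is `λ.transpose`. Rows,
columns and positions are numbered from `0`. -/

theorem card_transpose {lam : YoungDiagram} {d : ℕ} (h : lam.card = d) :
    lam.transpose.card = d := by
  rw [← h, YoungDiagram.card, YoungDiagram.card, YoungDiagram.transpose]
  exact Finset.card_map _

/-- The numbering of the cells of a diagram by their positions in the reading word: left to right
in the rows, and the rows from top to bottom. -/
def reading (lam : YoungDiagram) {d : ℕ} (h : lam.card = d) : Fin d ≃ {c // c ∈ lam.cells} :=
  ((lam.cells.map (toLex (α := ℕ × ℕ)).toEmbedding).orderIsoOfFin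
      (by rw [Finset.card_map]; exact h)).toEquiv.trans
    ((toLex (α := ℕ × ℕ)).symm.subtypeEquiv fun c => by
      simp only [Finset.mem_map, Equiv.coe_toEmbedding]
      exact ⟨by rintro ⟨x, hx, rfl⟩; exact hx, fun hc => ⟨_, hc, rfl⟩⟩)

/-- The cell `(i,j)` of a diagram corresponds to the cell `(j,i)` of the conjugate diagram. -/
def swapCells (lam : YoungDiagram) :
    {c // c ∈ lam.cells} ≃ {c // c ∈ lam.transpose.cells} :=
  (Equiv.prodComm ℕ ℕ).subtypeEquiv fun c => by
    rw [YoungDiagram.mem_cells, YoungDiagram.mem_cells, YoungDiagram.mem_transpose]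
    rfl

/-- The permutation `σ_λ`: it sends the position of a cell in the row-by-row numbering of the
diagram to the position of the same cell in the column-by-column numbering. -/
def sigmaPerm (lam : YoungDiagram) {d : ℕ} (h : lam.card = d) : Equiv.Perm (Fin d) :=
  ((reading lam h).trans (swapCells lam)).trans (reading lam.transpose (card_transpose h)).symm

/-- The Young subgroup `𝔖_{λ_1} × 𝔖_{λ_2} × ⋯` of `𝔖_d`: it consists of the permutations that keep
every position of the reading word in its row. -/
def IsYoung (lam : YoungDiagram) {d : ℕ} (h : lam.card = d) (σ : Equiv.Perm (Fin d)) : Prop :=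
  ∀ r, (reading lam h (σ r)).1.1 = (reading lam h r).1.1

/-! ### The functors `Γ_Π^λ` and `S^λ` at `M` -/

/-- `Γ_Π^λ M = Γ^{λ_1}(ΠM) ⊗ Γ^{λ_2}(ΠM) ⊗ ⋯`, the invariants of the Young subgroup in
`(ΠM)^{⊗d}`. -/
def gammaPi (k : Type*) [Field k] (m n : ℕ) (lam : YoungDiagram) {d : ℕ} (h : lam.card = d) :
    Submodule k (TensorPow k (m + n) d) where
  carrier := {w | ∀ σ, IsYoung lam h σ → superPerm k (parityPi m n) σ w = w}
  add_mem' ha hb σ hσ := by rw [map_add, ha σ hσ, hb σ hσ]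
  zero_mem' σ _ := map_zero _
  smul_mem' c w hw σ hσ := by rw [map_smul, hw σ hσ]

/-- The kernel of the projection from `M^{⊗d}` to the coinvariants of the Young subgroup. It is an
`S(m|n,d)`-submodule. -/
def symKer (k : Type*) [Field k] (m n : ℕ) (lam : YoungDiagram) {d : ℕ} (h : lam.card = d) :
    Submodule (schurAlgebra k m n d) (TensorPow k (m + n) d) where
  toAddSubmonoid := (Submodule.span k {w : TensorPow k (m + n) d | ∃ σ v, IsYoung lam h σ ∧
    w = superPerm k (parity m n) σ v - v}).toAddSubmonoid
  smul_mem' x w hw := by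
    change (x : Module.End k (TensorPow k (m + n) d)) w ∈ Submodule.span k _
    change w ∈ Submodule.span k _ at hw
    refine Submodule.span_induction ?_ ?_ ?_ ?_ hw
    · rintro _ ⟨σ, v, hσ, rfl⟩
      refine Submodule.subset_span ⟨σ, x.1 v, hσ, ?_⟩
      have hx := (Subalgebra.mem_centralizer_iff k).1 x.2 _ ⟨σ, rfl⟩
      rw [map_sub]
      congr 1
      exact (LinearMap.congr_fun hx v).symm
    · rw [map_zero]; exact Submodule.zero_mem _
    · intro a b _ _ ha hb
      rw [map_add]; exact Submodule.add_mem _ ha hb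
    · intro c a _ ha
      rw [map_smul]; exact Submodule.smul_mem _ _ ha

/-- `S^λ M = S^{λ_1} M ⊗ S^{λ_2} M ⊗ ⋯`, the coinvariants of the Young subgroup in `M^{⊗d}`, as an
`S(m|n,d)`-module. -/
abbrev SymPow (k : Type*) [Field k] (m n : ℕ) (lam : YoungDiagram) {d : ℕ} (h : lam.card = d) :
    Type _ :=
  TensorPow k (m + n) d ⧸ symKer k m n lam h

/-! ### Schur supermodules -/

/-- The map `1^{⊗d} : (ΠM)^{⊗d} → M^{⊗d}`, where `1 : ΠM → M` is the odd identity map; it acts by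
the rule of signs. -/
def unPi (k : Type*) [Field k] (m n d : ℕ) : Module.End k (TensorPow k (m + n) d) :=
  (Zw k (m + n) d).constr k fun i =>
    sgn k (ruleOfSigns (fun _ => 1) (parityPi m n ∘ i)) • Zw k (m + n) d i

theorem unPi_Zw (k : Type*) [Field k] (m n : ℕ) {d : ℕ} (i : Fin d → Fin (m + n)) :
    unPi k m n d (Zw k (m + n) d i) =
      sgn k (ruleOfSigns (fun _ => 1) (parityPi m n ∘ i)) • Zw k (m + n) d i := by
  simp [unPi]

theorem unPi_unPi (k : Type*) [Field k] (m n : ℕ) {d : ℕ} (v : TensorPow k (m + n) d) :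
    unPi k m n d (unPi k m n d v) = v := by
  have : unPi k m n d * unPi k m n d = 1 := by
    refine (Zw k (m + n) d).ext fun i => ?_
    rw [Module.End.mul_apply, unPi_Zw, map_smul, unPi_Zw, smul_smul, sgn_mul_self, one_smul]
    rfl
  exact LinearMap.congr_fun this v

theorem unPi_superPerm (k : Type*) [Field k] (m n : ℕ) {d : ℕ} (σ : Equiv.Perm (Fin d))
    (v : TensorPow k (m + n) d) :
    unPi k m n d (superPerm k (parityPi m n) σ v) =
      sgn k (invSum (fun _ => 1) σ) • superPerm k (parity m n) σ (unPi k m n d v) := by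
  have : unPi k m n d * superPerm k (parityPi m n) σ =
      sgn k (invSum (fun _ => 1) σ) • (superPerm k (parity m n) σ * unPi k m n d) := by
    refine (Zw k (m + n) d).ext fun i => ?_
    rw [LinearMap.smul_apply, Module.End.mul_apply, Module.End.mul_apply, superPerm_Zw, map_smul,
      unPi_Zw, unPi_Zw, map_smul, superPerm_Zw, smul_smul, smul_smul, smul_smul]
    congr 1
    set P : Fin d → ZMod 2 := fun _ => 1 with hP
    set Q : Fin d → ZMod 2 := parityPi m n ∘ i with hQ
    have h1 : parity m n ∘ i = P + Q := by
      funext a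
      simp [hP, hQ, parityPi, ← add_assoc, CharTwo.add_self_eq_zero]
    have h2 : parityPi m n ∘ (i ∘ σ) = Q ∘ σ := rfl
    have h3 : ruleOfSigns P (Q ∘ σ) = ruleOfSigns (P ∘ σ) (Q ∘ σ) := rfl
    rw [h2, h3, h1, invSum_add, sgn_add, sgn_add, sgn_add]
    linear_combination (-(sgn k (invSum Q σ) * sgn k (ruleOfSigns (P ∘ σ) (Q ∘ σ)))) *
      sgn_mul_self k (invSum P σ) -
      sgn k (invSum P σ) * sgn k (invSum P σ) * sgn k (invSum Q σ) *
        sgn k (ruleOfSigns (P ∘ σ) (Q ∘ σ)) * sgn_mul_self k (ruleOfSigns P Q)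
  exact LinearMap.congr_fun this v

/-- The map `θ̂_λ : Γ_Π^{λ'} M → S^λ M`: include `Γ_Π^{λ'} M` into `(ΠM)^{⊗d}`, pass to `M^{⊗d}`, let
`σ_λ` act, and multiply. -/
def thetaHat (k : Type*) [Field k] (m n : ℕ) (lam : YoungDiagram) {d : ℕ} (h : lam.card = d) :
    gammaPi k m n lam.transpose (card_transpose h) →ₗ[k] SymPow k m n lam h :=
  (((symKer k m n lam h).mkQ.restrictScalars k ∘ₗ superPerm k (parity m n) (sigmaPerm lam h)) ∘ₗ
    unPi k m n d) ∘ₗ (gammaPi k m n lam.transpose (card_transpose h)).subtype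

/-- The Schur supermodule `Ŝ_λ(M)`: the image of `θ̂_λ`, an `S(m|n,d)`-submodule of `S^λ M`. -/
def schurSupermodule (k : Type*) [Field k] (m n : ℕ) (lam : YoungDiagram) {d : ℕ}
    (h : lam.card = d) : Submodule (schurAlgebra k m n d) (SymPow k m n lam h) where
  toAddSubmonoid := (LinearMap.range (thetaHat k m n lam h)).toAddSubmonoid
  smul_mem' x w hw := by
    obtain ⟨⟨w, hw⟩, rfl⟩ := hw
    have hx : ∀ σ v, superPerm k (parity m n) σ (x.1 v) = x.1 (superPerm k (parity m n) σ v) :=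
      fun σ v => LinearMap.congr_fun ((Subalgebra.mem_centralizer_iff k).1 x.2 _ ⟨σ, rfl⟩) v
    refine ⟨⟨unPi k m n d (x.1 (unPi k m n d w)), ?_⟩, ?_⟩
    · intro σ hσ
      have h1 := unPi_superPerm k m n σ (unPi k m n d (x.1 (unPi k m n d w)))
      rw [unPi_unPi, hx, ← map_smul] at h1
      rw [← unPi_unPi k m n (superPerm k (parityPi m n) σ _), h1, ← unPi_superPerm, hw σ hσ]
    · change (symKer k m n lam h).mkQ (superPerm k (parity m n) (sigmaPerm lam h)
        (unPi k m n d (unPi k m n d (x.1 (unPi k m n d w))))) =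
        (symKer k m n lam h).mkQ (x • superPerm k (parity m n) (sigmaPerm lam h) (unPi k m n d w))
      rw [unPi_unPi, hx]
      rfl

/-! ### The canonical element -/

open Classical in
/-- The element `Z_Π^{(t)}` of the tableau with reading word `t`, as an element of `(ΠM)^{⊗d}`: the
signed sum of the `Z_Π^s` over the words `s` of the row equivalent tableaux. -/
def dividedZ (k : Type*) [Field k] (m n : ℕ) (lam : YoungDiagram) {d : ℕ} (h : lam.card = d)
    (t : Fin d → Fin (m + n)) : TensorPow k (m + n) d :=
  ∑ s, if hs : ∃ τ : Equiv.Perm (Fin d), IsYoung lam h τ ∧ t ∘ τ = s then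
    sgn k (invSum (parityPi m n ∘ t) hs.choose) • Zw k (m + n) d s
  else 0

theorem dividedZ_mem (k : Type*) [Field k] (m n : ℕ) (lam : YoungDiagram) {d : ℕ}
    (h : lam.card = d) (t : Fin d → Fin (m + n))
    (ht : ∀ a b, a ≠ b → parityPi m n (t a) = 1 → parityPi m n (t b) = 1 →
      (t a, (reading lam h a).1.1) ≠ (t b, (reading lam h b).1.1)) :
    dividedZ k m n lam h t ∈ gammaPi k m n lam h := by
  classical
  intro σ hσ
  rw [dividedZ, map_sum, ← Equiv.sum_comp (Equiv.arrowCongr σ.symm (Equiv.refl (Fin (m + n))))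
    (fun s => dite (∃ τ : Equiv.Perm (Fin d), IsYoung lam h τ ∧ t ∘ τ = s) _ _)]
  refine Finset.sum_congr rfl fun s _ => ?_
  have e : (Equiv.arrowCongr σ.symm (Equiv.refl (Fin (m + n)))) s = s ∘ σ := rfl
  rw [e]
  by_cases hs : ∃ τ : Equiv.Perm (Fin d), IsYoung lam h τ ∧ t ∘ τ = s
  · have hs' : ∃ τ : Equiv.Perm (Fin d), IsYoung lam h τ ∧ t ∘ τ = s ∘ σ := by
      obtain ⟨τ, hτ, rfl⟩ := hs
      exact ⟨τ * σ, fun r => (hτ (σ r)).trans (hσ r), rfl⟩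
    rw [dif_pos hs, dif_pos hs', map_smul, superPerm_Zw, smul_smul, ← sgn_add]
    congr 2
    have h1 : parityPi m n ∘ s = (parityPi m n ∘ t) ∘ hs.choose := by
      rw [Function.comp_assoc, hs.choose_spec.2]
    rw [h1, ← invSum_mul]
    refine invSum_eq_of_comp_eq _ (fun a => (t a, (reading lam h a).1.1))
      (fun a b hab ha hb => ht a b hab ha hb) ?_ _ _ ?_
    · intro a b hab
      simp only [Prod.mk.injEq] at hab
      simp [hab.1]
    · funext r
      refine Prod.ext ?_ ?_
      · have h2 := congrFun hs'.choose_spec.2 r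
        have h3 := congrFun hs.choose_spec.2 (σ r)
        exact h3.trans h2.symm
      · exact ((hs.choose_spec.1 (σ r)).trans (hσ r)).trans (hs'.choose_spec.1 r).symm
  · have hs' : ¬ ∃ τ : Equiv.Perm (Fin d), IsYoung lam h τ ∧ t ∘ τ = s ∘ σ := by
      rintro ⟨τ, hτ, h1⟩
      refine hs ⟨τ * σ⁻¹, fun r => (hτ (σ⁻¹ r)).trans ?_, ?_⟩
      · have := hσ (σ⁻¹ r)
        simpa using this.symm
      · funext a
        simpa using congrFun h1 (σ⁻¹ a)
    rw [dif_neg hs, dif_neg hs', map_zero]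

theorem col_lt {m : ℕ} {lam : YoungDiagram} (hl : lam.transpose.colLen 0 ≤ m)
    (c : {c // c ∈ lam.cells}) : c.1.2 < m := by
  refine lt_of_lt_of_le ?_ hl
  rw [← YoungDiagram.mem_iff_lt_colLen, YoungDiagram.mem_transpose]
  have hc : (c.1.1, c.1.2) ∈ lam := (YoungDiagram.mem_cells _).1 c.2
  exact lam.up_left_mem (Nat.zero_le _) le_rfl hc

/-- The reading word of the canonical tableau, `𝔠_λ(i,j) = j`, if all columns of the diagram have
number at most `m`. -/
def canonicalWord (m n : ℕ) (lam : YoungDiagram) {d : ℕ} (h : lam.card = d)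
    (hl : lam.transpose.colLen 0 ≤ m) : Fin d → Fin (m + n) :=
  fun r => ⟨(reading lam h r).1.2, (col_lt hl _).trans_le (Nat.le_add_right m n)⟩

theorem canonicalWord_mem (k : Type*) [Field k] (m n : ℕ) (lam : YoungDiagram) {d : ℕ}
    (h : lam.card = d) (hl : lam.transpose.colLen 0 ≤ m) :
    dividedZ k m n lam h (canonicalWord m n lam h hl) ∈
      gammaPi k m n lam.transpose.transpose (card_transpose (card_transpose h)) := by
  have key : ∀ (mu : YoungDiagram) (hmu : mu.card = d), mu = lam →
      dividedZ k m n lam h (canonicalWord m n lam h hl) ∈ gammaPi k m n mu hmu := by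
    rintro mu hmu rfl
    refine dividedZ_mem k m n mu h _ fun a b hab _ _ he => hab ?_
    simp only [canonicalWord, Prod.mk.injEq, Fin.mk.injEq] at he
    exact (reading mu h).injective (Subtype.ext (Prod.ext he.2 he.1))
  exact key _ _ lam.transpose_transpose

/-- The canonical element `Z_Π^{(𝔠_λ)}` of `Ŝ_{λ'}(M)`, that is, its image under
`θ̂_{λ'} : Γ_Π^λ M → Ŝ_{λ'}(M)`. -/
def canonicalElement (k : Type*) [Field k] (m n : ℕ) (lam : YoungDiagram) {d : ℕ}
    (h : lam.card = d) (hl : lam.transpose.colLen 0 ≤ m) :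
    schurSupermodule k m n lam.transpose (card_transpose h) :=
  ⟨thetaHat k m n lam.transpose (card_transpose h)
    ⟨dividedZ k m n lam h (canonicalWord m n lam h hl), canonicalWord_mem k m n lam h hl⟩,
    LinearMap.mem_range_self _ _⟩

/-! ### Submodules, invariants, indecomposability -/

/-- A linear subspace is an `N`-submodule if it is stable under the elements of `N`. -/
def IsNSubmodule {k A V : Type*} [Field k] [Ring A] [Algebra k A] [AddCommGroup V] [Module k V]
    [Module A V] (N : Submodule k A) (W : Submodule k V) : Prop :=
  ∀ x ∈ N, ∀ v ∈ W, x • v ∈ W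

/-- The space of `N`-invariants: the vectors that are killed by all elements of `N`. -/
def nInvariants {k A V : Type*} [Field k] [Ring A] [Algebra k A] [AddCommGroup V] [Module k V]
    [Module A V] [IsScalarTower k A V] (N : Submodule k A) : Submodule k V where
  carrier := {v | ∀ x ∈ N, x • v = 0}
  add_mem' ha hb x hx := by rw [smul_add, ha x hx, hb x hx, add_zero]
  zero_mem' x _ := smul_zero x
  smul_mem' c v hv x hx := by rw [← algebraMap_smul A c v, ← mul_smul, ← Algebra.commutes c x, mul_smul, hv x hx, smul_zero]

/-- `V` is `N`-indecomposable: it is nonzero, and not the direct sum of two nonzero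
`N`-submodules. -/
def IsNIndecomposable {k A V : Type*} [Field k] [Ring A] [Algebra k A] [AddCommGroup V]
    [Module k V] [Module A V] (N : Submodule k A) : Prop :=
  Nontrivial V ∧ ∀ W₁ W₂ : Submodule k V, IsNSubmodule N W₁ → IsNSubmodule N W₂ →
    IsCompl W₁ W₂ → W₁ = ⊥ ∨ W₂ = ⊥

end SchurSuper

end

/-! Put μ = λ', and let c be the word on the diagram of μ whose letter in each cell is the number of
its row; by l(λ') ≤ m these letters are even. The sign twist of 1^{⊗d} turns 𝔖_λ-invariants into
tensors that alternate along the columns of μ. Thus every element of the Schur supermodule lifts to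
a column alternating tensor, and the canonical element lifts to one, w₀, that is supported on
rearrangements of c and has a nonzero coordinate at c.

The first main fact is `eq_zero_of_support`. Since 2 ≠ 0, a column alternating tensor has coordinate
zero at any word that repeats an even letter within a column. If a rearrangement of a word c' ≤ c
has distinct letters in each column, then comparing sums of letters forces c' = c and makes the
rearrangement a column permutation of c. So the content of c carries at most a line of column
alternating tensors, and the content of a smaller word carries none. Hence N(m|n,d) kills w₀, and
each E^{(c,j)} maps column alternating tensors to multiples of w₀.

The second is `exists_ge_rowWord`: a column alternating tensor that is nonzero in the coinvariants
is detected at c by some E^{(c,j)} with c ≤ j. For j one takes an extremal word of a normal form. If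
c ≤ j failed, decreasing some letters of c by one would give c' < c with E^{(c',j)} nonzero on the
tensor, against the first fact.

Subtracting from a lift the multiple of w₀ with the same coordinate at c yields the dichotomy
`mem_span_or_exists_smul`: an element is a multiple of the canonical one, or some element of
N(m|n,d) maps it to a nonzero multiple. This gives (i) and (ii); for (iii), two nonzero submodules
share the canonical element. -/

noncomputable section

namespace SchurSuper

/-! ### Signs of transpositions -/

theorem sgn_ne_zero (k : Type*) [Field k] (e : ZMod 2) : sgn k e ≠ 0 :=
  left_ne_zero_of_mul_eq_one (sgn_mul_self k e)

theorem sgn_zero (k : Type*) [Field k] : sgn k 0 = 1 := by simp [sgn]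

theorem sgn_one (k : Type*) [Field k] : sgn k 1 = -1 := by simp [sgn, ZMod.val_one]

theorem invSum_eq_zero {d : ℕ} {ε : Fin d → ZMod 2} (h : ∀ r, ε r = 0) (σ : Equiv.Perm (Fin d)) :
    invSum ε σ = 0 := by
  simp [invSum, h]

theorem invSum_swap {d : ℕ} {ε : Fin d → ZMod 2} {x y : Fin d} (hxy : x ≠ y) (hx : ε x = 1)
    (hy : ε y = 1) : invSum ε (Equiv.swap x y) = 1 := by
  wlog h : x < y generalizing x y with H
  · rw [Equiv.swap_comm]
    exact H hxy.symm hy hx (lt_of_le_of_ne (not_lt.1 h) hxy.symm)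
  -- The pairs inverted by the transposition are (x, y), the pairs (x, t) and the pairs (s, y), with
  -- t and s strictly between x and y.
  have key : ∀ s t, (if s < t ∧ (Equiv.swap x y).symm t < (Equiv.swap x y).symm s then
      ε s * ε t else 0) = (if s = x then (if t = y then 1 else 0) else 0) +
      ((if s = x then (if x < t ∧ t < y then ε t else 0) else 0) +
      (if t = y then (if x < s ∧ s < y then ε s else 0) else 0)) := by
    intro s t
    rw [Equiv.symm_swap, Equiv.swap_apply_def, Equiv.swap_apply_def]
    by_cases hsx : s = x
    · subst hsx
      by_cases hty : t = y
      · subst hty; simp [h, h.ne', hx, hy]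
      · by_cases hts : t = s
        · subst hts; simp [h.ne]
        · simp [hty, hts, hx]
    · by_cases hty : t = y
      · subst hty
        by_cases hst : s = t
        · subst hst; simp [hsx]
        · simp [hst, hsx, hy, h.ne', and_comm]
      · by_cases hsy : s = y
        · subst hsy
          by_cases htx : t = x
          · subst htx; simp [hsx, hty, h.not_gt]
          · simp only [htx, hty, hsx, if_false, if_true]
            simp only [add_zero, ite_eq_right_iff]
            intro h1
            exact absurd (h1.1.trans h1.2) (not_lt.2 h.le)
        · by_cases htx : t = x
          · subst htx
            simp only [hty, hsx, hsy, if_false, if_true]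
            simp only [add_zero, ite_eq_right_iff]
            intro h1
            exact absurd (h1.1.trans h) (not_lt.2 h1.2.le)
          · simp only [hty, hsx, hsy, htx, if_false]
            simp only [add_zero, ite_eq_right_iff]
            intro h1
            exact absurd h1.1 h1.2.not_gt
  unfold invSum
  simp only [key, Finset.sum_add_distrib, Finset.sum_ite_irrel, Finset.sum_const_zero,
    Finset.sum_ite_eq', Finset.mem_univ, if_true]
  -- The two sums over the positions between x and y coincide, so they cancel modulo 2.
  rw [CharTwo.add_self_eq_zero, add_zero]

theorem apply_swap_eq {ι α : Type*} [DecidableEq ι] (f : ι → α) {x y : ι} (hf : f x = f y) (r : ι) :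
    f (Equiv.swap x y r) = f r := by
  rcases eq_or_ne r x with rfl | h1
  · simp [hf]
  rcases eq_or_ne r y with rfl | h2
  · simp [hf]
  rw [Equiv.swap_apply_of_ne_of_ne h1 h2]

theorem invSum_one_mul {d : ℕ} (σ τ : Equiv.Perm (Fin d)) :
    invSum (fun _ => 1) (σ * τ) = invSum (fun _ => 1) σ + invSum (fun _ => 1) τ :=
  invSum_mul _ σ τ

/-- Shifting all parities by one reduces this to odd positions: the exponents for 1 + ε and for 1
are both 1, and the two rule-of-signs terms in `invSum_add` agree because the transposition fixes ε.
-/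
theorem invSum_swap_eq_zero {d : ℕ} {ε : Fin d → ZMod 2} {x y : Fin d} (hxy : x ≠ y)
    (hx : ε x = 0) (hy : ε y = 0) : invSum ε (Equiv.swap x y) = 0 := by
  have h := invSum_add (fun _ => 1) ε (Equiv.swap x y)
  rw [invSum_swap hxy (by simp [hx]) (by simp [hy]), invSum_swap hxy rfl rfl] at h
  have e : ε ∘ Equiv.swap x y = ε := funext (apply_swap_eq ε (hx.trans hy.symm))
  have e' : (fun _ => 1 : Fin d → ZMod 2) ∘ Equiv.swap x y = fun _ => 1 := rfl
  rw [e, e', add_assoc (1 + _), CharTwo.add_self_eq_zero] at h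
  simpa using h

/-! ### The symmetric group acting on tensor powers -/

theorem superPerm_superPerm (k : Type*) [Field k] {N d : ℕ} (p : Fin N → ZMod 2)
    (σ τ : Equiv.Perm (Fin d)) (v : TensorPow k N d) :
    superPerm k p τ (superPerm k p σ v) = superPerm k p (σ * τ) v := by
  have : superPerm k p τ * superPerm k p σ = superPerm k p (σ * τ) := by
    refine (Zw k N d).ext fun i => ?_
    rw [Module.End.mul_apply, superPerm_Zw, map_smul, superPerm_Zw, superPerm_Zw, smul_smul,
      invSum_mul, sgn_add]
    rfl
  exact LinearMap.congr_fun this v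

theorem repr_superPerm (k : Type*) [Field k] {N d : ℕ} (p : Fin N → ZMod 2)
    (σ : Equiv.Perm (Fin d)) (v : TensorPow k N d) (s : Fin d → Fin N) :
    (Zw k N d).repr (superPerm k p σ v) (s ∘ σ) =
      sgn k (invSum (p ∘ s) σ) * (Zw k N d).repr v s := by
  have : (Zw k N d).coord (s ∘ σ) ∘ₗ superPerm k p σ =
      sgn k (invSum (p ∘ s) σ) • (Zw k N d).coord s := by
    refine (Zw k N d).ext fun i => ?_
    rw [LinearMap.comp_apply, superPerm_Zw, map_smul, LinearMap.smul_apply]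
    simp only [Module.Basis.coord_apply, Module.Basis.repr_self]
    by_cases h : i = s
    · subst h; simp
    · have h' : i ∘ σ ≠ s ∘ σ := fun e => h (σ.surjective.injective_comp_right e)
      simp [Finsupp.single_eq_of_ne' h, Finsupp.single_eq_of_ne' h']
  exact LinearMap.congr_fun this v

theorem mem_schurAlgebra_apply {k : Type*} [Field k] {m n d : ℕ} (x : schurAlgebra k m n d)
    (σ : Equiv.Perm (Fin d)) (v : TensorPow k (m + n) d) :
    superPerm k (parity m n) σ (x.1 v) = x.1 (superPerm k (parity m n) σ v) :=
  LinearMap.congr_fun ((Subalgebra.mem_centralizer_iff k).1 x.2 _ ⟨σ, rfl⟩) v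

theorem repr_dividedE (k : Type*) [Field k] (m n : ℕ) {d : ℕ} (i j s : Fin d → Fin (m + n))
    (v : TensorPow k (m + n) d) :
    (Zw k (m + n) d).repr (dividedE k m n i j v) s =
      ∑ l, (Zw k (m + n) d).repr v l * (orbitCoeff k m n i j s l *
        sgn k (ruleOfSigns (parity m n ∘ s + parity m n ∘ l) (parity m n ∘ l))) := by
  conv_lhs => rw [← (Zw k (m + n) d).sum_repr v]
  simp only [map_sum, map_smul, dividedE_Zw, Finsupp.coe_finsetSum, Finset.sum_apply,
    Finsupp.smul_apply, Module.Basis.repr_self, smul_eq_mul]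
  refine Finset.sum_congr rfl fun l _ => ?_
  congr 1
  rw [Finset.sum_eq_single s]
  · simp
  · intro t _ ht
    simp [Finsupp.single_eq_of_ne' ht]
  · simp

/-- E^{(i,j)} carries a word j∘τ only to words i∘τ' with j∘τ' = j∘τ, so only the listed coordinates
of v can contribute at s. -/
theorem repr_dividedE_eq_zero (k : Type*) [Field k] (m n : ℕ) {d : ℕ}
    {i j s : Fin d → Fin (m + n)} {v : TensorPow k (m + n) d}
    (h : ∀ τ : Equiv.Perm (Fin d), i ∘ τ = s → (Zw k (m + n) d).repr v (j ∘ τ) = 0) :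
    (Zw k (m + n) d).repr (dividedE k m n i j v) s = 0 := by
  rw [repr_dividedE]
  refine Finset.sum_eq_zero fun l _ => ?_
  by_cases hτ : ∃ τ : Equiv.Perm (Fin d), i ∘ τ = s ∧ j ∘ τ = l
  · obtain ⟨τ, h1, rfl⟩ := hτ
    rw [h τ h1, zero_mul]
  · rw [orbitCoeff, dif_neg hτ, zero_mul, mul_zero]

theorem parity_eq_zero {m n : ℕ} {a : Fin (m + n)} (h : (a : ℕ) < m) : parity m n a = 0 := by
  simp [parity, h]

/-! ### Numbers of rows and columns -/

/-- The row of the cell with a given position in the reading word. -/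
def rowOf (mu : YoungDiagram) {d : ℕ} (h : mu.card = d) (r : Fin d) : ℕ := (reading mu h r).1.1

/-- The column of the cell with a given position in the reading word. -/
def colOf (mu : YoungDiagram) {d : ℕ} (h : mu.card = d) (r : Fin d) : ℕ := (reading mu h r).1.2

theorem mem_rowOf_colOf (mu : YoungDiagram) {d : ℕ} (h : mu.card = d) (r : Fin d) :
    (rowOf mu h r, colOf mu h r) ∈ mu :=
  (YoungDiagram.mem_cells _).1 (reading mu h r).2

theorem exists_rowOf_colOf {mu : YoungDiagram} {d : ℕ} (h : mu.card = d) {a b : ℕ}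
    (hab : (a, b) ∈ mu) : ∃ r, rowOf mu h r = a ∧ colOf mu h r = b := by
  refine ⟨(reading mu h).symm ⟨(a, b), (YoungDiagram.mem_cells _).2 hab⟩, ?_, ?_⟩ <;>
    simp [rowOf, colOf]

theorem eq_of_rowOf_colOf {mu : YoungDiagram} {d : ℕ} (h : mu.card = d) {r s : Fin d}
    (h1 : rowOf mu h r = rowOf mu h s) (h2 : colOf mu h r = colOf mu h s) : r = s :=
  (reading mu h).injective (Subtype.ext (Prod.ext h1 h2))

theorem rowOf_lt {mu : YoungDiagram} {d : ℕ} (h : mu.card = d) {m : ℕ} (hm : mu.colLen 0 ≤ m)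
    (r : Fin d) : rowOf mu h r < m := by
  refine lt_of_lt_of_le ?_ hm
  rw [← YoungDiagram.mem_iff_lt_colLen]
  exact mu.up_left_mem le_rfl (Nat.zero_le _) (mem_rowOf_colOf mu h r)

/-- The word whose letter at each position is the number of the row of that position. -/
def rowWord (m n : ℕ) (mu : YoungDiagram) {d : ℕ} (h : mu.card = d) (hm : mu.colLen 0 ≤ m) :
    Fin d → Fin (m + n) :=
  fun r => ⟨rowOf mu h r, (rowOf_lt h hm r).trans_le (Nat.le_add_right m n)⟩

/-! ### A minimality property of the row word -/

/-- The largest element of a finite set of naturals is at least the number of the remaining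
elements; induction removes it. -/
theorem sum_range_le_sum (A : Finset ℕ) : ∑ a ∈ Finset.range A.card, a ≤ ∑ a ∈ A, a := by
  induction A using Finset.induction_on_max with
  | empty => simp
  | insert a s hs ih =>
    have ha : a ∉ s := fun h => lt_irrefl _ (hs a h)
    rw [Finset.card_insert_of_notMem ha, Finset.sum_range_succ, Finset.sum_insert ha, add_comm]
    refine add_le_add ?_ ih
    have : s ⊆ Finset.range a := fun x hx => Finset.mem_range.2 (hs x hx)
    simpa using Finset.card_le_card this

theorem eq_range_of_sum_le (A : Finset ℕ) (h : ∑ a ∈ A, a ≤ ∑ a ∈ Finset.range A.card, a) :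
    A = Finset.range A.card := by
  induction A using Finset.induction_on_max with
  | empty => simp
  | insert a s hs ih =>
    have ha : a ∉ s := fun h => lt_irrefl _ (hs a h)
    rw [Finset.card_insert_of_notMem ha, Finset.sum_range_succ, Finset.sum_insert ha] at h
    have h1 : s.card ≤ a := by
      have : s ⊆ Finset.range a := fun x hx => Finset.mem_range.2 (hs x hx)
      simpa using Finset.card_le_card this
    have h2 := sum_range_le_sum s
    have h3 : a = s.card := by omega
    have h4 := ih (by omega)
    rw [Finset.card_insert_of_notMem ha, Finset.range_add_one, ← h4, ← h3]

theorem image_rowOf (mu : YoungDiagram) {d : ℕ} (h : mu.card = d) (q : ℕ) :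
    (Finset.univ.filter fun r => colOf mu h r = q).image (rowOf mu h) =
      Finset.range (mu.colLen q) := by
  ext a
  simp only [Finset.mem_image, Finset.mem_filter, Finset.mem_univ, true_and, Finset.mem_range,
    ← YoungDiagram.mem_iff_lt_colLen]
  constructor
  · rintro ⟨r, rfl, rfl⟩
    exact mem_rowOf_colOf mu h r
  · intro ha
    obtain ⟨r, h1, h2⟩ := exists_rowOf_colOf h ha
    exact ⟨r, h2, h1⟩

/-- If a rearrangement `s` of a sequence bounded by the row numbers takes distinct values in each
column, then the sequence consists of the row numbers, and `s` permutes each column. -/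
theorem exists_perm_of_injOn_columns (mu : YoungDiagram) {d : ℕ} (h : mu.card = d)
    {c s : Fin d → ℕ} (hc : ∀ r, c r ≤ rowOf mu h r) (τ : Equiv.Perm (Fin d)) (hs : c ∘ τ = s)
    (hcol : ∀ x y, x ≠ y → colOf mu h x = colOf mu h y → s x ≠ s y) :
    c = rowOf mu h ∧ ∃ π : Equiv.Perm (Fin d), (∀ r, colOf mu h (π r) = colOf mu h r) ∧
      ∀ r, s r = rowOf mu h (π r) := by
  classical
  -- Within a column both s and the row numbers are injective, so the letters in a column form a set
  -- of the same size as {0, …, colLen − 1}.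
  have hcard : ∀ q, ((Finset.univ.filter fun r => colOf mu h r = q).image s).card =
      mu.colLen q := by
    intro q
    rw [Finset.card_image_of_injOn, ← Finset.card_range (mu.colLen q), ← image_rowOf mu h q,
      Finset.card_image_of_injOn]
    · intro x hx y hy hxy
      simp only [Finset.coe_filter, Finset.mem_univ, true_and, Set.mem_ofPred_eq] at hx hy
      exact eq_of_rowOf_colOf h hxy (hx.trans hy.symm)
    · intro x hx y hy hxy
      simp only [Finset.coe_filter, Finset.mem_univ, true_and, Set.mem_ofPred_eq] at hx hy
      by_contra hne
      exact hcol x y hne (hx.trans hy.symm) hxy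
  have hsumR : ∀ q, ∑ r with colOf mu h r = q, rowOf mu h r =
      ∑ a ∈ Finset.range (mu.colLen q), a := by
    intro q
    rw [← image_rowOf mu h q, Finset.sum_image]
    intro x hx y hy hxy
    simp only [Finset.coe_filter, Finset.mem_univ, true_and, Set.mem_ofPred_eq] at hx hy
    exact eq_of_rowOf_colOf h hxy (hx.trans hy.symm)
  have hsumS : ∀ q, ∑ r with colOf mu h r = q, s r =
      ∑ a ∈ (Finset.univ.filter fun r => colOf mu h r = q).image s, a := by
    intro q
    rw [Finset.sum_image]
    intro x hx y hy hxy
    simp only [Finset.coe_filter, Finset.mem_univ, true_and, Set.mem_ofPred_eq] at hx hy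
    by_contra hne
    exact hcol x y hne (hx.trans hy.symm) hxy
  have hle : ∀ q, ∑ r with colOf mu h r = q, rowOf mu h r ≤ ∑ r with colOf mu h r = q, s r := by
    intro q
    rw [hsumR, hsumS, ← hcard q]
    exact sum_range_le_sum _
  have hfibR := Finset.sum_fiberwise_of_maps_to (s := Finset.univ)
    (fun r _ => Finset.mem_image_of_mem (colOf mu h) (Finset.mem_univ r)) (rowOf mu h)
  have hfibS := Finset.sum_fiberwise_of_maps_to (s := Finset.univ)
    (fun r _ => Finset.mem_image_of_mem (colOf mu h) (Finset.mem_univ r)) s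
  -- This closes the chain ∑ row ≤ ∑ s = ∑ c ≤ ∑ row, so equality holds throughout: in each cell for
  -- c, and in each column for s.
  have hRS : ∑ r, rowOf mu h r ≤ ∑ r, s r := by
    rw [← hfibR, ← hfibS]
    exact Finset.sum_le_sum fun q _ => hle q
  have hSc : ∑ r, s r = ∑ r, c r := by
    rw [← hs]
    exact Equiv.sum_comp τ c
  have hcR : ∑ r, c r ≤ ∑ r, rowOf mu h r := Finset.sum_le_sum fun r _ => hc r
  refine ⟨?_, ?_⟩
  · have := (Finset.sum_eq_sum_iff_of_le fun r _ => hc r).1 (by omega : ∑ r, c r = ∑ r, rowOf mu h r)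
    exact funext fun r => this r (Finset.mem_univ r)
  have hq : ∀ q ∈ Finset.univ.image (colOf mu h),
      ∑ r with colOf mu h r = q, rowOf mu h r = ∑ r with colOf mu h r = q, s r := by
    refine (Finset.sum_eq_sum_iff_of_le fun q _ => hle q).1 ?_
    rw [hfibR, hfibS]
    omega
  -- A set of colLen naturals with minimal sum is an initial segment, so the letter s r is the
  -- number of a row that meets the column of r.
  have hmem : ∀ r, (s r, colOf mu h r) ∈ mu := by
    intro r
    have h1 := hq _ (Finset.mem_image_of_mem _ (Finset.mem_univ r))
    rw [hsumR, hsumS, ← hcard] at h1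
    have h2 := eq_range_of_sum_le _ h1.ge
    rw [hcard] at h2
    rw [YoungDiagram.mem_iff_lt_colLen, ← Finset.mem_range, ← h2]
    exact Finset.mem_image_of_mem _ (by simp)
  choose π h1 h2 using fun r => exists_rowOf_colOf h (hmem r)
  have hπ : Function.Injective π := by
    intro x y hxy
    by_contra hne
    refine hcol x y hne ?_ ?_
    · rw [← h2 x, ← h2 y, hxy]
    · rw [← h1 x, ← h1 y, hxy]
  exact ⟨Equiv.ofBijective π (Finite.injective_iff_bijective.1 hπ), h2, fun r => (h1 r).symm⟩

/-! ### Column alternating tensors -/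

/-- The tensors on which the permutations of positions within the columns act by their signs. -/
def colAlternating (k : Type*) [Field k] (m n : ℕ) (mu : YoungDiagram) {d : ℕ} (h : mu.card = d) :
    Submodule k (TensorPow k (m + n) d) where
  carrier := {v | ∀ π : Equiv.Perm (Fin d), (∀ r, colOf mu h (π r) = colOf mu h r) →
    superPerm k (parity m n) π v = sgn k (invSum (fun _ => 1) π) • v}
  add_mem' ha hb π hπ := by rw [map_add, ha π hπ, hb π hπ, smul_add]
  zero_mem' π _ := by rw [map_zero, smul_zero]
  smul_mem' c v hv π hπ := by rw [map_smul, hv π hπ, smul_comm]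

section

variable {k : Type*} [Field k] {m n d : ℕ} {mu : YoungDiagram} {h : mu.card = d}

theorem rowOf_sigmaPerm (r : Fin d) :
    rowOf mu.transpose (card_transpose h) (sigmaPerm mu h r) = colOf mu h r := by
  simp [rowOf, colOf, sigmaPerm, swapCells]

theorem colOf_sigmaPerm (r : Fin d) :
    colOf mu.transpose (card_transpose h) (sigmaPerm mu h r) = rowOf mu h r := by
  simp [rowOf, colOf, sigmaPerm, swapCells]

/-- Conjugation by `sigmaPerm` identifies column permutations of μ with row permutations of its
conjugate, and 1^{⊗d} exchanges invariance for alternation. -/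
theorem superPerm_sigmaPerm_mem {w : TensorPow k (m + n) d}
    (hw : w ∈ gammaPi k m n mu.transpose (card_transpose h)) :
    superPerm k (parity m n) (sigmaPerm mu h) (unPi k m n d w) ∈ colAlternating k m n mu h := by
  intro π hπ
  set σ : Equiv.Perm (Fin d) := sigmaPerm mu h * π * (sigmaPerm mu h)⁻¹ with hσ
  have hσY : IsYoung mu.transpose (card_transpose h) σ := by
    intro r
    change rowOf mu.transpose (card_transpose h) _ = rowOf mu.transpose (card_transpose h) _
    obtain ⟨r, rfl⟩ := (sigmaPerm mu h).surjective r
    rw [rowOf_sigmaPerm, ← hπ, ← rowOf_sigmaPerm]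
    simp [hσ]
  have h1 := unPi_superPerm k m n σ w
  rw [hw σ hσY] at h1
  have h2 : superPerm k (parity m n) σ (unPi k m n d w) =
      sgn k (invSum (fun _ => 1) σ) • unPi k m n d w := by
    conv_rhs => rw [h1]
    rw [smul_smul, sgn_mul_self, one_smul]
  have h3 : sigmaPerm mu h * π = σ * sigmaPerm mu h := by simp [hσ]
  have h4 : invSum (fun _ => 1) σ = invSum (fun _ => 1) π := by
    have := congrArg (invSum fun _ => 1) h3
    rw [invSum_one_mul, invSum_one_mul, add_comm] at this
    exact (add_right_cancel this).symm
  rw [superPerm_superPerm, h3, ← superPerm_superPerm, h2, map_smul, h4]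

theorem apply_mem_colAlternating (x : schurAlgebra k m n d) {v : TensorPow k (m + n) d}
    (hv : v ∈ colAlternating k m n mu h) : x.1 v ∈ colAlternating k m n mu h := by
  intro π hπ
  rw [mem_schurAlgebra_apply, hv π hπ, map_smul]

theorem repr_comp_eq_zero {v : TensorPow k (m + n) d} (hv : v ∈ colAlternating k m n mu h)
    {π : Equiv.Perm (Fin d)} (hπ : ∀ r, colOf mu h (π r) = colOf mu h r)
    {s : Fin d → Fin (m + n)} (hs : (Zw k (m + n) d).repr v s = 0) :
    (Zw k (m + n) d).repr v (s ∘ π) = 0 := by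
  have h1 := repr_superPerm k (parity m n) π v s
  rw [hv π hπ, hs, mul_zero, map_smul, Finsupp.smul_apply, smul_eq_mul] at h1
  exact (mul_eq_zero.1 h1).resolve_left (sgn_ne_zero k _)

/-- The transposition of the two cells multiplies v by −1, yet fixes s with sign +1 because the
repeated letter is even; hence twice the coordinate vanishes. -/
theorem repr_eq_zero_of_eq (hk : (2 : k) ≠ 0) {v : TensorPow k (m + n) d}
    (hv : v ∈ colAlternating k m n mu h) {s : Fin d → Fin (m + n)} {x y : Fin d} (hxy : x ≠ y)
    (hcol : colOf mu h x = colOf mu h y) (hs : s x = s y) (hp : parity m n (s x) = 0) :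
    (Zw k (m + n) d).repr v s = 0 := by
  have h1 := repr_superPerm k (parity m n) (Equiv.swap x y) v s
  rw [hv _ (apply_swap_eq _ hcol), invSum_swap hxy rfl rfl,
    invSum_swap_eq_zero hxy hp (by simpa [hs] using hp),
    show s ∘ Equiv.swap x y = s from funext (apply_swap_eq s hs), map_smul, Finsupp.smul_apply, sgn_one, sgn_zero, smul_eq_mul] at h1
  have h2 : (2 : k) * (Zw k (m + n) d).repr v s = 0 := by linear_combination -h1
  exact (mul_eq_zero.1 h2).resolve_left hk

/-- The weight spaces of the column alternating tensors: they vanish for the weights that dominate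
the weight of the row word, whose weight space is at most one-dimensional. -/
theorem eq_zero_of_support (hk : (2 : k) ≠ 0) (hm : mu.colLen 0 ≤ m) {v : TensorPow k (m + n) d}
    (hv : v ∈ colAlternating k m n mu h) {c : Fin d → Fin (m + n)}
    (hc : ∀ r, (c r : ℕ) ≤ rowOf mu h r)
    (hsupp : ∀ s, (Zw k (m + n) d).repr v s ≠ 0 → ∃ τ : Equiv.Perm (Fin d), c ∘ τ = s)
    (h0 : c = rowWord m n mu h hm → (Zw k (m + n) d).repr v c = 0) : v = 0 := by
  refine (Zw k (m + n) d).repr.injective ?_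
  rw [map_zero]
  ext s
  by_contra hs
  obtain ⟨τ, hτ⟩ := hsupp s hs
  have hp : ∀ r, parity m n (s r) = 0 := by
    intro r
    rw [← hτ]
    exact parity_eq_zero ((hc _).trans_lt (rowOf_lt h hm _))
  -- All letters are bounded by row numbers and hence even, so a nonzero coordinate forces distinct
  -- letters in each column.
  obtain ⟨h1, π, hπ, h2⟩ := exists_perm_of_injOn_columns mu h (c := fun r => (c r : ℕ))
    (s := fun r => (s r : ℕ)) hc τ (by rw [← hτ]; rfl) fun x y hxy hcol he =>
      hs (repr_eq_zero_of_eq hk hv hxy hcol (Fin.ext he) (hp x))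
  have hcw : c = rowWord m n mu h hm := funext fun r => Fin.ext (congrFun h1 r)
  have hsc : s = c ∘ π := by
    funext r
    rw [hcw]
    exact Fin.ext (h2 r)
  exact hs (hsc ▸ repr_comp_eq_zero hv hπ (h0 hcw))

/-! ### Functionals on the coinvariants -/

open Classical in
/-- The functional that takes the value `1` at the words that arise from `i` by permutations
within the rows. -/
def rowCoeff (k : Type*) [Field k] (m n : ℕ) (mu : YoungDiagram) {d : ℕ} (h : mu.card = d)
    (i : Fin d → Fin (m + n)) : TensorPow k (m + n) d →ₗ[k] k :=
  (Zw k (m + n) d).constr k fun l => if ∃ ρ, IsYoung mu h ρ ∧ i ∘ ρ = l then 1 else 0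

open Classical in
theorem rowCoeff_Zw (i l : Fin d → Fin (m + n)) : rowCoeff k m n mu h i (Zw k (m + n) d l) =
    if ∃ ρ, IsYoung mu h ρ ∧ i ∘ ρ = l then 1 else 0 := by
  rw [rowCoeff, Module.Basis.constr_basis]

theorem IsYoung.mul {σ τ : Equiv.Perm (Fin d)} (hσ : IsYoung mu h σ) (hτ : IsYoung mu h τ) :
    IsYoung mu h (σ * τ) := fun r => (hσ (τ r)).trans (hτ r)

theorem IsYoung.inv {σ : Equiv.Perm (Fin d)} (hσ : IsYoung mu h σ) : IsYoung mu h σ⁻¹ := by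
  intro r
  have := hσ (σ⁻¹ r)
  simpa using this.symm

/-- For a word of even letters, row permutations act without signs on its row orbit, so the
functional descends to the coinvariants. -/
theorem rowCoeff_eq_zero {i : Fin d → Fin (m + n)} (hi : ∀ r, parity m n (i r) = 0)
    {v : TensorPow k (m + n) d} (hv : v ∈ symKer k m n mu h) : rowCoeff k m n mu h i v = 0 := by
  classical
  change v ∈ Submodule.span k _ at hv
  refine (Submodule.span_le (p := LinearMap.ker (rowCoeff k m n mu h i))).2 ?_ hv
  rintro _ ⟨σ, w, hσ, rfl⟩
  have key : rowCoeff k m n mu h i ∘ₗ superPerm k (parity m n) σ = rowCoeff k m n mu h i := by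
    refine (Zw k (m + n) d).ext fun l => ?_
    rw [LinearMap.comp_apply, superPerm_Zw, map_smul, rowCoeff_Zw, rowCoeff_Zw]
    by_cases hl : ∃ ρ, IsYoung mu h ρ ∧ i ∘ ρ = l
    · obtain ⟨ρ, hρ, rfl⟩ := hl
      rw [if_pos ⟨ρ * σ, hρ.mul hσ, rfl⟩, if_pos ⟨ρ, hρ, rfl⟩,
        invSum_eq_zero (ε := parity m n ∘ i ∘ ρ) (fun r => hi (ρ r)) σ, sgn_zero, one_smul]
    · rw [if_neg hl, if_neg, smul_zero]
      rintro ⟨ρ, hρ, e⟩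
      refine hl ⟨ρ * σ⁻¹, hρ.mul hσ.inv, ?_⟩
      funext r
      simpa using congrFun e (σ⁻¹ r)
  rw [SetLike.mem_coe, LinearMap.mem_ker, map_sub, sub_eq_zero]
  exact LinearMap.congr_fun key w

theorem rowCoeff_dividedE_eq_zero {i j : Fin d → Fin (m + n)} (hi : ∀ r, parity m n (i r) = 0)
    (hij : IsStrict m n i j) {v : TensorPow k (m + n) d} (hv : v ∈ symKer k m n mu h) :
    rowCoeff k m n mu h i (dividedE k m n i j v) = 0 :=
  rowCoeff_eq_zero hi ((symKer k m n mu h).smul_mem (schurE k m n i j hij) hv)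

theorem exists_of_rowCoeff_dividedE_Zw_ne_zero {i j l : Fin d → Fin (m + n)}
    (hne : rowCoeff k m n mu h i (dividedE k m n i j (Zw k (m + n) d l)) ≠ 0) :
    ∃ σ ρ : Equiv.Perm (Fin d), IsYoung mu h ρ ∧ i ∘ σ = i ∧ l = (j ∘ σ) ∘ ρ := by
  classical
  rw [dividedE_Zw, map_sum] at hne
  obtain ⟨s, _, hs⟩ := Finset.exists_ne_zero_of_sum_ne_zero hne
  rw [map_smul, rowCoeff_Zw, smul_eq_mul] at hs
  have h1 : ∃ ρ, IsYoung mu h ρ ∧ i ∘ ρ = s := by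
    by_contra h1
    rw [if_neg h1, mul_zero] at hs
    exact hs rfl
  have h2 : ∃ τ : Equiv.Perm (Fin d), i ∘ τ = s ∧ j ∘ τ = l := by
    by_contra h2
    rw [orbitCoeff, dif_neg h2, zero_mul, zero_mul] at hs
    exact hs rfl
  obtain ⟨ρ, hρ, rfl⟩ := h1
  obtain ⟨τ, h3, rfl⟩ := h2
  refine ⟨τ * ρ⁻¹, ρ, hρ, ?_, ?_⟩
  · funext r
    simpa using congrFun h3 (ρ⁻¹ r)
  · funext r
    simp

theorem rowCoeff_dividedE_Zw_self_ne_zero {i j : Fin d → Fin (m + n)}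
    (huniq : ∀ τ ρ : Equiv.Perm (Fin d), IsYoung mu h ρ → i ∘ τ = i ∘ ρ → j ∘ τ = j → i ∘ τ = i) :
    rowCoeff k m n mu h i (dividedE k m n i j (Zw k (m + n) d j)) ≠ 0 := by
  classical
  rw [dividedE_Zw, map_sum, Finset.sum_eq_single i]
  · have h1 : ∃ τ : Equiv.Perm (Fin d), i ∘ τ = i ∧ j ∘ τ = j := ⟨1, rfl, rfl⟩
    rw [map_smul, rowCoeff_Zw, if_pos ⟨1, fun _ => rfl, rfl⟩, smul_eq_mul, mul_one, orbitCoeff,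
      dif_pos h1]
    exact mul_ne_zero (sgn_ne_zero k _) (sgn_ne_zero k _)
  · intro s _ hs
    rw [map_smul, rowCoeff_Zw, smul_eq_mul]
    by_cases h1 : ∃ ρ, IsYoung mu h ρ ∧ i ∘ ρ = s
    · by_cases h2 : ∃ τ : Equiv.Perm (Fin d), i ∘ τ = s ∧ j ∘ τ = j
      · obtain ⟨ρ, hρ, rfl⟩ := h1
        obtain ⟨τ, h3, h4⟩ := h2
        exact absurd (h3.symm.trans (huniq τ ρ hρ h3 h4)) hs
      · rw [orbitCoeff, dif_neg h2, zero_mul, zero_mul]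
    · rw [if_neg h1, mul_zero]
  · simp

/-- Permutations within the rows fix the row word, so its row orbit is a single word. -/
theorem rowCoeff_rowWord (hm : mu.colLen 0 ≤ m) (v : TensorPow k (m + n) d) :
    rowCoeff k m n mu h (rowWord m n mu h hm) v =
      (Zw k (m + n) d).repr v (rowWord m n mu h hm) := by
  classical
  have : rowCoeff k m n mu h (rowWord m n mu h hm) =
      (Zw k (m + n) d).coord (rowWord m n mu h hm) := by
    refine (Zw k (m + n) d).ext fun l => ?_
    rw [rowCoeff_Zw, Module.Basis.coord_apply, Module.Basis.repr_self, Finsupp.single_apply]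
    refine if_congr ⟨?_, ?_⟩ rfl rfl
    · rintro ⟨ρ, hρ, rfl⟩
      exact funext fun r => Fin.ext (hρ r)
    · rintro rfl
      exact ⟨1, fun _ => rfl, rfl⟩
  rw [this, Module.Basis.coord_apply]

/-! ### Normal forms in the coinvariants -/

theorem parity_rowWord (hm : mu.colLen 0 ≤ m) (r : Fin d) :
    parity m n (rowWord m n mu h hm r) = 0 :=
  parity_eq_zero (rowOf_lt h hm r)

/-- Failure of strictness means that an odd letter occurs twice in one row. Exchanging the two
occurrences negates Z^l, so −2 Z^l lies in the kernel. -/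
theorem Zw_mem_symKer (hk : (2 : k) ≠ 0) (hm : mu.colLen 0 ≤ m) {l : Fin d → Fin (m + n)}
    (hl : ¬ IsStrict m n (rowWord m n mu h hm) l) : Zw k (m + n) d l ∈ symKer k m n mu h := by
  simp only [IsStrict, not_forall, not_not, parity_rowWord, zero_add] at hl
  obtain ⟨x, y, hxy, hx, hy, he⟩ := hl
  simp only [Prod.mk.injEq] at he
  have hY : IsYoung mu h (Equiv.swap x y) := apply_swap_eq (rowOf mu h) (Fin.ext_iff.1 he.1)
  change _ ∈ Submodule.span k _
  have h1 : superPerm k (parity m n) (Equiv.swap x y) (Zw k (m + n) d l) - Zw k (m + n) d l =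
      (-2 : k) • Zw k (m + n) d l := by
    rw [superPerm_Zw, invSum_swap hxy hx hy, sgn_one,
      show l ∘ Equiv.swap x y = l from funext (apply_swap_eq l he.2)]
    module
  have h2 : (-2 : k) • Zw k (m + n) d l ∈ Submodule.span k {w : TensorPow k (m + n) d |
      ∃ σ v, IsYoung mu h σ ∧ w = superPerm k (parity m n) σ v - v} :=
    Submodule.subset_span ⟨_, _, hY, h1.symm⟩
  exact (Submodule.smul_mem_iff _ (neg_ne_zero.2 hk)).1 h2

/-- Modulo the kernel each basis tensor is a scalar multiple of a chosen representative of its row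
orbit, and the scalar may be taken to be zero at representatives that are not strict. Hence κ is
supported on strict words, at most one in each row orbit. -/
theorem exists_normalForm (hk : (2 : k) ≠ 0) (hm : mu.colLen 0 ≤ m)
    (v : TensorPow k (m + n) d) : ∃ κ : (Fin d → Fin (m + n)) → k,
      (∀ l, κ l ≠ 0 → IsStrict m n (rowWord m n mu h hm) l) ∧
      (∀ l ρ, IsYoung mu h ρ → κ l ≠ 0 → κ (l ∘ ρ) ≠ 0 → l ∘ ρ = l) ∧
      v - ∑ l, κ l • Zw k (m + n) d l ∈ symKer k m n mu h := by
  classical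
  let S : Setoid (Fin d → Fin (m + n)) :=
    { r := fun l l' => ∃ ρ, IsYoung mu h ρ ∧ l ∘ ρ = l'
      iseqv :=
        { refl := fun l => ⟨1, fun _ => rfl, rfl⟩
          symm := by
            rintro l _ ⟨ρ, hρ, rfl⟩
            exact ⟨ρ⁻¹, hρ.inv, by funext r; simp⟩
          trans := by
            rintro l _ _ ⟨ρ, hρ, rfl⟩ ⟨τ, hτ, rfl⟩
            exact ⟨ρ * τ, hρ.mul hτ, rfl⟩ } }
  let rep : (Fin d → Fin (m + n)) → Fin d → Fin (m + n) := fun l => (Quotient.mk S l).out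
  have hrep : ∀ l, ∃ ρ, IsYoung mu h ρ ∧ rep l ∘ ρ = l := fun l => Quotient.mk_out (s := S) l
  have hex : ∀ l, ∃ a : k, (a ≠ 0 → IsStrict m n (rowWord m n mu h hm) (rep l)) ∧
      Zw k (m + n) d l - a • Zw k (m + n) d (rep l) ∈ symKer k m n mu h := by
    intro l
    obtain ⟨ρ, hρ, hl⟩ := hrep l
    have h1 : superPerm k (parity m n) ρ (Zw k (m + n) d (rep l)) - Zw k (m + n) d (rep l) ∈
        symKer k m n mu h := Submodule.subset_span ⟨_, _, hρ, rfl⟩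
    rw [superPerm_Zw, hl] at h1
    have h2 := Submodule.smul_of_tower_mem (symKer k m n mu h)
      (sgn k (invSum (parity m n ∘ rep l) ρ)) h1
    rw [smul_sub, smul_smul, sgn_mul_self, one_smul] at h2
    by_cases hs : IsStrict m n (rowWord m n mu h hm) (rep l)
    · exact ⟨_, fun _ => hs, h2⟩
    · refine ⟨0, fun h0 => absurd rfl h0, ?_⟩
      have h3 := Submodule.smul_of_tower_mem (symKer k m n mu h)
        (sgn k (invSum (parity m n ∘ rep l) ρ)) (Zw_mem_symKer hk hm hs)
      simpa using Submodule.add_mem _ h2 h3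
  choose a ha1 ha2 using hex
  let κ : (Fin d → Fin (m + n)) → k := fun l' =>
    ∑ l with rep l = l', (Zw k (m + n) d).repr v l * a l
  have hκ : ∀ l', κ l' ≠ 0 → ∃ l, rep l = l' ∧ a l ≠ 0 := by
    intro l' hl'
    obtain ⟨l, hl, h1⟩ := Finset.exists_ne_zero_of_sum_ne_zero hl'
    exact ⟨l, (Finset.mem_filter.1 hl).2, right_ne_zero_of_mul h1⟩
  refine ⟨κ, ?_, ?_, ?_⟩
  · intro l' hl'
    obtain ⟨l, rfl, h1⟩ := hκ l' hl'
    exact ha1 l h1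
  · intro l ρ hρ h1 h2
    obtain ⟨l1, e1, -⟩ := hκ _ h1
    obtain ⟨l2, e2, -⟩ := hκ _ h2
    have h3 : Quotient.mk S l = Quotient.mk S l1 := by
      rw [← e1]; exact Quotient.out_eq _
    have h4 : Quotient.mk S (l ∘ ρ) = Quotient.mk S l2 := by
      rw [← e2]; exact Quotient.out_eq _
    have h5 : Quotient.mk S l = Quotient.mk S (l ∘ ρ) := Quotient.sound ⟨ρ, hρ, rfl⟩
    rw [← e2, ← e1]
    change (Quotient.mk S l2).out = (Quotient.mk S l1).out
    rw [← h3, ← h4, h5]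
  · have h1 : ∑ l, κ l • Zw k (m + n) d l =
        ∑ l, (Zw k (m + n) d).repr v l • a l • Zw k (m + n) d (rep l) := by
      conv_rhs => rw [← Finset.sum_fiberwise_of_maps_to (s := Finset.univ) (t := Finset.univ)
        (fun l _ => Finset.mem_univ (rep l))]
      refine Finset.sum_congr rfl fun l' _ => ?_
      rw [Finset.sum_smul]
      refine Finset.sum_congr rfl fun l hl => ?_
      rw [(Finset.mem_filter.1 hl).2, mul_smul]
    have h2 : v - ∑ l, κ l • Zw k (m + n) d l = ∑ l, (Zw k (m + n) d).repr v l •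
        (Zw k (m + n) d l - a l • Zw k (m + n) d (rep l)) := by
      rw [h1]
      simp only [smul_sub, Finset.sum_sub_distrib, Module.Basis.sum_repr]
    rw [h2]
    exact Submodule.sum_mem _ fun l _ => Submodule.smul_of_tower_mem _ _ (ha2 l)

end

/-! ### Detecting column alternating tensors in the coinvariants -/

section

variable {k : Type*} [Field k] {m n d : ℕ} {mu : YoungDiagram} {h : mu.card = d}

theorem exists_perm_comp_eq {α β : Type*} [Fintype α] [DecidableEq β] (f g : α → β)
    (hfg : ∀ b, (Finset.univ.filter fun a => f a = b).card =
      (Finset.univ.filter fun a => g a = b).card) : ∃ σ : Equiv.Perm α, g ∘ σ = f := by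
  have e : ∀ b, {a // f a = b} ≃ {a // g a = b} := fun b => Fintype.equivOfCardEq (by
    rw [Fintype.card_subtype, Fintype.card_subtype, hfg b])
  exact ⟨Equiv.ofFiberEquiv e, funext fun a => Equiv.ofFiberEquiv_map e a⟩

/-- By `hsing` only the term Z^j of the normal form can contribute, and by `huniq` only the word i
in E^{(i,j)} Z^j is counted by the functional; what remains is ±κ(j). -/
theorem rowCoeff_dividedE_ne_zero {v : TensorPow k (m + n) d}
    {κ : (Fin d → Fin (m + n)) → k} (hκ : v - ∑ l, κ l • Zw k (m + n) d l ∈ symKer k m n mu h)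
    {i j : Fin d → Fin (m + n)} (hi : ∀ r, parity m n (i r) = 0) (hij : IsStrict m n i j)
    (hj : κ j ≠ 0)
    (huniq : ∀ τ ρ : Equiv.Perm (Fin d), IsYoung mu h ρ → i ∘ τ = i ∘ ρ → j ∘ τ = j → i ∘ τ = i)
    (hsing : ∀ σ ρ : Equiv.Perm (Fin d), IsYoung mu h ρ → i ∘ σ = i →
      κ ((j ∘ σ) ∘ ρ) ≠ 0 → (j ∘ σ) ∘ ρ = j) :
    rowCoeff k m n mu h i (dividedE k m n i j v) ≠ 0 := by
  have h1 := rowCoeff_dividedE_eq_zero hi hij hκ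
  rw [map_sub, map_sub, sub_eq_zero] at h1
  rw [h1, map_sum, map_sum, Finset.sum_eq_single j]
  · rw [map_smul, map_smul, smul_eq_mul]
    exact mul_ne_zero hj (rowCoeff_dividedE_Zw_self_ne_zero huniq)
  · intro l _ hl
    rw [map_smul, map_smul, smul_eq_mul]
    by_contra hne
    obtain ⟨σ, ρ, hρ, h2, rfl⟩ :=
      exists_of_rowCoeff_dividedE_Zw_ne_zero (right_ne_zero_of_mul hne)
    exact hl (hsing σ ρ hρ h2 (left_ne_zero_of_mul hne))
  · simp

/-- A column alternating tensor with nonzero image in the coinvariants has a nonzero coordinate at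
a word that is bounded below by the row word. -/
theorem exists_ge_rowWord (hk : (2 : k) ≠ 0) (hm : mu.colLen 0 ≤ m) {v : TensorPow k (m + n) d}
    (hv : v ∈ colAlternating k m n mu h) (hv0 : v ∉ symKer k m n mu h) :
    ∃ j, IsStrict m n (rowWord m n mu h hm) j ∧ rowWord m n mu h hm ≤ j ∧
      (Zw k (m + n) d).repr (dividedE k m n (rowWord m n mu h hm) j v)
        (rowWord m n mu h hm) ≠ 0 := by
  classical
  set c := rowWord m n mu h hm with hcdef
  have hcY : ∀ ρ, IsYoung mu h ρ → c ∘ ρ = c := fun ρ hρ => funext fun r => Fin.ext (hρ r)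
  obtain ⟨κ, hκ1, hκ2, hκ3⟩ := exists_normalForm hk hm v
  have hne : (Finset.univ.filter fun l => κ l ≠ 0).Nonempty := by
    by_contra hemp
    rw [Finset.not_nonempty_iff_eq_empty, Finset.filter_eq_empty_iff] at hemp
    have : ∀ l, κ l = 0 := fun l => not_not.1 (hemp (Finset.mem_univ l))
    exact hv0 (by simpa [this] using hκ3)
  -- The extremal word maximizes the sum of row number times letter, an invariant of the row orbit.
  obtain ⟨j, hj, hmax⟩ := Finset.exists_max_image _
    (fun l : Fin d → Fin (m + n) => ∑ r, (rowOf mu h r : ℤ) * ((l r : ℕ) : ℤ)) hne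
  have hj0 : κ j ≠ 0 := (Finset.mem_filter.1 hj).2
  have hmax' : ∀ l, κ l ≠ 0 → ∑ r, (rowOf mu h r : ℤ) * ((l r : ℕ) : ℤ) ≤
      ∑ r, (rowOf mu h r : ℤ) * ((j r : ℕ) : ℤ) := fun l hl =>
    hmax l (Finset.mem_filter.2 ⟨Finset.mem_univ l, hl⟩)
  have hstrict := hκ1 j hj0
  refine ⟨j, hstrict, ?_, ?_⟩
  swap
  · rw [← rowCoeff_rowWord]
    refine rowCoeff_dividedE_ne_zero hκ3 (parity_rowWord hm) hstrict hj0 ?_ ?_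
    · intro τ ρ hρ h1 _
      exact h1.trans (hcY ρ hρ)
    · intro σ ρ hρ h1 h2
      have hσ : IsYoung mu h σ := fun r => congrArg Fin.val (congrFun h1 r)
      exact hκ2 j (σ * ρ) (hσ.mul hρ) hj0 h2
  by_contra hbad
  have hbad' : (Finset.univ.filter fun r => (j r : ℕ) < rowOf mu h r).Nonempty := by
    simp only [Pi.le_def, not_forall, not_le] at hbad
    obtain ⟨r, hr⟩ := hbad
    exact ⟨r, Finset.mem_filter.2 ⟨Finset.mem_univ r, hr⟩⟩
  -- Among the cells whose letter is less than the row number, take one with the least letter a = j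
  -- r₀.
  obtain ⟨r₀, hr₀, hmin⟩ := Finset.exists_min_image _ (fun r => (j r : ℕ)) hbad'
  have hr₀' : (j r₀ : ℕ) < rowOf mu h r₀ := (Finset.mem_filter.1 hr₀).2
  have hmin' : ∀ r, (j r : ℕ) < rowOf mu h r → (j r₀ : ℕ) ≤ j r := fun r hr =>
    hmin r (Finset.mem_filter.2 ⟨Finset.mem_univ r, hr⟩)
  obtain ⟨t, ht⟩ : ∃ t, rowOf mu h r₀ = t + 1 := ⟨rowOf mu h r₀ - 1, by omega⟩
  have htm : t + 1 < m := ht ▸ rowOf_lt h hm r₀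
  have hat : (j r₀ : ℕ) ≤ t := by omega
  -- P consists of the cells of row t + 1 with letter a; c' decreases the row word by one exactly on
  -- P.
  let P : Finset (Fin d) := Finset.univ.filter fun r => rowOf mu h r = t + 1 ∧ j r = j r₀
  have hP : ∀ r, r ∈ P ↔ rowOf mu h r = t + 1 ∧ j r = j r₀ := fun r => by simp [P]
  let c' : Fin d → Fin (m + n) := fun r => if r ∈ P then ⟨t, by omega⟩ else c r
  have hc'1 : ∀ r, r ∈ P → (c' r : ℕ) = t := fun r hr => by simp [c', hr]
  have hc'2 : ∀ r, r ∉ P → (c' r : ℕ) = rowOf mu h r := fun r hr => by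
    simp [c', hr, hcdef, rowWord]
  have hc'le : ∀ r, (c' r : ℕ) ≤ rowOf mu h r := by
    intro r
    by_cases hr : r ∈ P
    · rw [hc'1 r hr, ((hP r).1 hr).1]; omega
    · rw [hc'2 r hr]
  have hc't : ∀ r, (c' r : ℕ) = t → t ≤ rowOf mu h r := fun r hr => hr ▸ hc'le r
  have hpar : ∀ r, parity m n (c' r) = 0 := fun r =>
    parity_eq_zero ((hc'le r).trans_lt (rowOf_lt h hm r))
  have hne' : c' ≠ c := by
    intro e
    have h1 := hc'1 r₀ ((hP r₀).2 ⟨ht, rfl⟩)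
    rw [e] at h1
    change rowOf mu h r₀ = t at h1
    omega
  have hstrict' : IsStrict m n c' j := by
    intro x y hxy hx hy he
    rw [hpar, zero_add] at hx hy
    have hnP : ∀ z, parity m n (j z) = 1 → z ∉ P := by
      intro z hz hzP
      rw [((hP z).1 hzP).2, parity_eq_zero (by omega)] at hz
      exact zero_ne_one hz
    simp only [Prod.mk.injEq] at he
    refine hstrict x y hxy (by rw [parity_rowWord, zero_add, hx])
      (by rw [parity_rowWord, zero_add, hy]) (Prod.ext ?_ he.2)
    have h1 := congrArg Fin.val he.1
    rw [hc'2 x (hnP x hx), hc'2 y (hnP y hy)] at h1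
    exact Fin.ext h1
  -- The content of c' < c supports no column alternating tensor; the rest of the proof shows that
  -- this operator should nevertheless be nonzero on v.
  have hzero : dividedE k m n c' j v = 0 := by
    refine eq_zero_of_support hk hm (apply_mem_colAlternating (schurE k m n c' j hstrict') hv)
      hc'le ?_ fun e => absurd e hne'
    intro s hs
    by_contra hτ
    exact hs (repr_dividedE_eq_zero k m n fun τ e => absurd ⟨τ, e⟩ hτ)
  refine rowCoeff_dividedE_ne_zero hκ3 hpar hstrict' hj0 ?_ ?_ (by rw [hzero, map_zero])
  · intro τ ρ hρ h1 h2
    have hsle : ∀ r, (c' (τ r) : ℕ) ≤ rowOf mu h r := by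
      intro r
      have := congrArg Fin.val (congrFun h1 r)
      rw [Function.comp_apply, Function.comp_apply] at this
      rw [this]
      exact (hc'le _).trans (hρ r).le
    have hsge : ∀ r, r ∈ P → t ≤ c' (τ r) := by
      intro r hr
      have h3 := congrArg Fin.val (congrFun h1 r)
      rw [Function.comp_apply, Function.comp_apply] at h3
      have h4 : rowOf mu h (ρ r) = t + 1 := (hρ r).trans ((hP r).1 hr).1
      by_cases h5 : ρ r ∈ P
      · rw [h3, hc'1 _ h5]
      · rw [h3, hc'2 _ h5, h4]; omega
    have hsoff : ∀ r, r ∉ P → j r = j r₀ → (c' (τ r) : ℕ) = c' r := by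
      intro r hr hjr
      have h3 := congrArg Fin.val (congrFun h1 r)
      rw [Function.comp_apply, Function.comp_apply] at h3
      have h4 : rowOf mu h (ρ r) = rowOf mu h r := hρ r
      have h5 : ρ r ∉ P := fun h6 => hr ((hP r).2 ⟨h4 ▸ ((hP _).1 h6).1, hjr⟩)
      rw [h3, hc'2 _ h5, h4, hc'2 _ hr]
    -- Since τ fixes j, it permutes the cells with letter a. There c'∘τ ≥ c', so equal sums force
    -- equality.
    have hsum1 : ∑ r, (if j r = j r₀ then (c' r : ℕ) else 0) =
        ∑ r, (if j r = j r₀ then (c' (τ r) : ℕ) else 0) := by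
      rw [← Equiv.sum_comp τ]
      refine Finset.sum_congr rfl fun r _ => ?_
      rw [show j (τ r) = j r from congrFun h2 r]
    have heqP : ∀ r, j r = j r₀ → (c' r : ℕ) = c' (τ r) := by
      intro r hr
      have := (Finset.sum_eq_sum_iff_of_le ?_).1 hsum1 r (Finset.mem_univ r)
      · simpa [hr] using this
      · intro r _
        split_ifs with hjr
        · by_cases hr : r ∈ P
          · rw [hc'1 r hr]; exact hsge r hr
          · rw [hsoff r hr hjr]
        · exact le_rfl
    -- Equality on P, and c'∘τ = c'∘ρ ≤ row = c' off P; as τ preserves the total sum, c'∘τ = c'.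
    have hle : ∀ r, (c' (τ r) : ℕ) ≤ c' r := by
      intro r
      by_cases hr : r ∈ P
      · rw [heqP r ((hP r).1 hr).2]
      · rw [hc'2 r hr]; exact hsle r
    have hsum2 : ∑ r, (c' (τ r) : ℕ) = ∑ r, (c' r : ℕ) := Equiv.sum_comp τ fun r => (c' r : ℕ)
    funext r
    exact Fin.ext ((Finset.sum_eq_sum_iff_of_le fun r _ => hle r).1 hsum2 r (Finset.mem_univ r))
  · intro σ ρ hρ h1 h2
    have hc'σ : ∀ r, (c' (σ r) : ℕ) = c' r := fun r => congrArg Fin.val (congrFun h1 r)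
    have hsplit : ∀ (f : ℕ → ℤ) (G : Fin d → ℤ), ∑ r, f (rowOf mu h r) * G r =
        ∑ r, f (c' r) * G r + ∑ r ∈ P, (f (t + 1) - f t) * G r := by
      intro f G
      rw [← Finset.sum_ite_mem_eq P, ← Finset.sum_add_distrib]
      refine Finset.sum_congr rfl fun r _ => ?_
      by_cases hr : r ∈ P
      · rw [if_pos hr, hc'1 r hr, ((hP r).1 hr).1]; ring
      · rw [if_neg hr, hc'2 r hr, add_zero]
    -- The row numbers exceed c' only on P, and σ preserves c', so replacing j by j∘σ changes a
    -- row-weighted sum only through the cells of P. The identity is used with the sum that was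
    -- maximized and with indicator functions.
    have hdiff : ∀ (f : ℕ → ℤ) (F : Fin (m + n) → ℤ),
        ∑ r, f (rowOf mu h r) * F (j (σ r)) = ∑ r, f (rowOf mu h r) * F (j r) +
          (f (t + 1) - f t) * ∑ r ∈ P, (F (j (σ r)) - F (j r₀)) := by
      intro f F
      rw [hsplit f fun r => F (j (σ r)), hsplit f fun r => F (j r)]
      have e1 : ∑ r, f (c' r) * F (j (σ r)) = ∑ r, f (c' r) * F (j r) := by
        rw [← Equiv.sum_comp σ fun r => f (c' r) * F (j r)]
        exact Finset.sum_congr rfl fun r _ => by rw [hc'σ]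
      have e2 : ∑ r ∈ P, (f (t + 1) - f t) * F (j r) =
          ∑ r ∈ P, (f (t + 1) - f t) * F (j r₀) :=
        Finset.sum_congr rfl fun r hr => by rw [((hP r).1 hr).2]
      rw [e1, e2, Finset.sum_sub_distrib, ← Finset.mul_sum, ← Finset.mul_sum]
      ring
    -- For r in P the cell σ r lies in row at least t. A letter below a ≤ t would be less than its
    -- row number, against the minimality of a.
    have hge : ∀ r, r ∈ P → (j r₀ : ℕ) ≤ j (σ r) := by
      intro r hr
      by_contra hlt
      have h3 : t ≤ rowOf mu h (σ r) := hc't _ ((hc'σ r).trans (hc'1 r hr))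
      exact hlt (hmin' (σ r) (by omega))
    have hmx := hmax' _ h2
    have e1 : ∑ r, (rowOf mu h r : ℤ) * (((j ∘ σ) ∘ ρ) r : ℕ) =
        ∑ r, (rowOf mu h r : ℤ) * (j (σ r) : ℕ) := by
      rw [← Equiv.sum_comp ρ fun r => (rowOf mu h r : ℤ) * (j (σ r) : ℕ)]
      refine Finset.sum_congr rfl fun r _ => ?_
      rw [show rowOf mu h (ρ r) = rowOf mu h r from hρ r]
      rfl
    rw [e1, hdiff (fun b => (b : ℤ)) fun a => ((a : ℕ) : ℤ)] at hmx
    have h3 : ∑ r ∈ P, (((j (σ r) : ℕ) : ℤ) - ((j r₀ : ℕ) : ℤ)) ≤ 0 := by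
      push_cast at hmx
      linarith
    have hnn : ∀ r ∈ P, (0 : ℤ) ≤ ((j (σ r) : ℕ) : ℤ) - ((j r₀ : ℕ) : ℤ) := fun r hr =>
      sub_nonneg.2 (Int.ofNat_le.2 (hge r hr))
    have h4 := (Finset.sum_eq_zero_iff_of_nonneg hnn).1
      (le_antisymm h3 (Finset.sum_nonneg hnn))
    have h5 : ∀ r, r ∈ P → j (σ r) = j r₀ := by
      intro r hr
      have := h4 r hr
      exact Fin.ext (by omega)
    -- By maximality j∘σ has the constant letter a on P, so each pair of row and letter occurs
    -- equally often in j∘σ and in j. Hence the two words differ by a permutation within the rows.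
    obtain ⟨σ', hσ'⟩ := exists_perm_comp_eq (fun r => (rowOf mu h r, j (σ r)))
      (fun r => (rowOf mu h r, j r)) (by
        rintro ⟨b, x⟩
        have := hdiff (fun b' => if b' = b then 1 else 0) (fun x' => if x' = x then 1 else 0)
        rw [Finset.sum_eq_zero (s := P) fun r hr => by rw [h5 r hr, sub_self], mul_zero,
          add_zero] at this
        simp only [Finset.card_filter, Prod.mk.injEq]
        rw [← Nat.cast_inj (R := ℤ)]
        simpa only [ite_and, ite_mul, one_mul, zero_mul, Nat.cast_sum, Nat.cast_ite, Nat.cast_one,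
          Nat.cast_zero] using this)
    have hσY : IsYoung mu h σ' := fun r => (Prod.ext_iff.1 (congrFun hσ' r)).1
    have h6 : j ∘ σ = j ∘ σ' := funext fun r => (Prod.ext_iff.1 (congrFun hσ' r)).2.symm
    rw [h6] at h2 ⊢
    exact hκ2 j (σ' * ρ) (hσY.mul hρ) hj0 h2

end

/-! ### The canonical element -/

section

variable {k : Type*} [Field k] {m n d : ℕ} {lam : YoungDiagram} {hd : lam.card = d}

/-- The tensor in `M^{⊗d}` whose image in the coinvariants is the canonical element. -/
def canonicalTensor (k : Type*) [Field k] (m n : ℕ) (lam : YoungDiagram) {d : ℕ}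
    (hd : lam.card = d) (hl : lam.transpose.colLen 0 ≤ m) : TensorPow k (m + n) d :=
  superPerm k (parity m n) (sigmaPerm lam.transpose (card_transpose hd))
    (unPi k m n d (dividedZ k m n lam hd (canonicalWord m n lam hd hl)))

theorem canonicalTensor_mem (hl : lam.transpose.colLen 0 ≤ m) :
    canonicalTensor k m n lam hd hl ∈
      colAlternating k m n lam.transpose (card_transpose hd) :=
  superPerm_sigmaPerm_mem (canonicalWord_mem k m n lam hd hl)

theorem mkQ_canonicalTensor (hl : lam.transpose.colLen 0 ≤ m) :
    (canonicalElement k m n lam hd hl).1 = (symKer k m n lam.transpose (card_transpose hd)).mkQ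
      (canonicalTensor k m n lam hd hl) := rfl

theorem canonicalWord_comp_sigmaPerm (hl : lam.transpose.colLen 0 ≤ m) :
    canonicalWord m n lam hd hl ∘ sigmaPerm lam.transpose (card_transpose hd) =
      rowWord m n lam.transpose (card_transpose hd) hl := by
  -- The double transpose equals `lam` only propositionally, so the equality is generalized and then
  -- substituted.
  have key : ∀ (nu : YoungDiagram) (hnu : nu.card = d), nu = lam →
      colOf nu hnu = colOf lam hd := by
    rintro nu hnu rfl
    rfl
  funext r
  refine Fin.ext ?_
  change colOf lam hd _ = rowOf lam.transpose (card_transpose hd) r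
  rw [← colOf_sigmaPerm, key _ _ lam.transpose_transpose]

theorem repr_unPi (v : TensorPow k (m + n) d) (s : Fin d → Fin (m + n)) :
    (Zw k (m + n) d).repr (unPi k m n d v) s =
      sgn k (ruleOfSigns (fun _ => 1) (parityPi m n ∘ s)) * (Zw k (m + n) d).repr v s := by
  have : (Zw k (m + n) d).coord s ∘ₗ unPi k m n d =
      sgn k (ruleOfSigns (fun _ => 1) (parityPi m n ∘ s)) • (Zw k (m + n) d).coord s := by
    refine (Zw k (m + n) d).ext fun i => ?_
    rw [LinearMap.comp_apply, unPi_Zw, map_smul, LinearMap.smul_apply]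
    simp only [Module.Basis.coord_apply, Module.Basis.repr_self]
    by_cases h : i = s
    · subst h; simp
    · simp [Finsupp.single_eq_of_ne' h]
  exact LinearMap.congr_fun this v

open Classical in
theorem repr_dividedZ (t s : Fin d → Fin (m + n)) :
    (Zw k (m + n) d).repr (dividedZ k m n lam hd t) s =
      if hs : ∃ τ : Equiv.Perm (Fin d), IsYoung lam hd τ ∧ t ∘ τ = s then
        sgn k (invSum (parityPi m n ∘ t) hs.choose) else 0 := by
  rw [dividedZ, map_sum, Finsupp.coe_finsetSum, Finset.sum_apply, Finset.sum_eq_single s]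
  · split_ifs <;> simp
  · intro s' _ hs'
    split_ifs
    · simp [Finsupp.single_eq_of_ne' hs']
    · simp
  · simp

theorem repr_canonicalTensor (hl : lam.transpose.colLen 0 ≤ m) (s : Fin d → Fin (m + n)) :
    ∃ a : k, a ≠ 0 ∧ (Zw k (m + n) d).repr (canonicalTensor k m n lam hd hl)
      (s ∘ sigmaPerm lam.transpose (card_transpose hd)) =
      a * (Zw k (m + n) d).repr (dividedZ k m n lam hd (canonicalWord m n lam hd hl)) s := by
  refine ⟨sgn k (invSum (parity m n ∘ s) (sigmaPerm lam.transpose (card_transpose hd))) *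
    sgn k (ruleOfSigns (fun _ => 1) (parityPi m n ∘ s)),
    mul_ne_zero (sgn_ne_zero k _) (sgn_ne_zero k _), ?_⟩
  rw [canonicalTensor, repr_superPerm, repr_unPi, mul_assoc]

theorem repr_canonicalTensor_ne_zero (hl : lam.transpose.colLen 0 ≤ m) :
    (Zw k (m + n) d).repr (canonicalTensor k m n lam hd hl)
      (rowWord m n lam.transpose (card_transpose hd) hl) ≠ 0 := by
  classical
  obtain ⟨a, ha, h1⟩ := repr_canonicalTensor (k := k) (hd := hd) hl (canonicalWord m n lam hd hl)
  rw [canonicalWord_comp_sigmaPerm, repr_dividedZ, dif_pos ⟨1, fun _ => rfl, rfl⟩] at h1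
  rw [h1]
  exact mul_ne_zero ha (sgn_ne_zero k _)

theorem exists_comp_of_repr_canonicalTensor (hl : lam.transpose.colLen 0 ≤ m)
    {s : Fin d → Fin (m + n)}
    (hs : (Zw k (m + n) d).repr (canonicalTensor k m n lam hd hl) s ≠ 0) :
    ∃ τ : Equiv.Perm (Fin d),
      rowWord m n lam.transpose (card_transpose hd) hl ∘ τ = s := by
  classical
  set σ := sigmaPerm lam.transpose (card_transpose hd) with hσ
  have e : (s ∘ σ.symm) ∘ σ = s := by funext r; simp
  obtain ⟨a, ha, h1⟩ := repr_canonicalTensor (k := k) (hd := hd) hl (s ∘ σ.symm)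
  rw [← hσ, e, repr_dividedZ] at h1
  by_cases h2 : ∃ τ : Equiv.Perm (Fin d), IsYoung lam hd τ ∧
      canonicalWord m n lam hd hl ∘ τ = s ∘ σ.symm
  · obtain ⟨τ, -, h3⟩ := h2
    refine ⟨σ⁻¹ * τ * σ, ?_⟩
    rw [← canonicalWord_comp_sigmaPerm, ← hσ]
    funext r
    have := congrFun h3 (σ r)
    simpa using this
  · rw [dif_neg h2, mul_zero] at h1
    exact absurd h1 hs

/-- The image is column alternating and supported on rearrangements of the row word, where such
tensors are determined by their coordinate at that word. -/
theorem dividedE_rowWord_eq_smul (hk : (2 : k) ≠ 0) (hl : lam.transpose.colLen 0 ≤ m)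
    {v : TensorPow k (m + n) d}
    (hv : v ∈ colAlternating k m n lam.transpose (card_transpose hd))
    {j : Fin d → Fin (m + n)}
    (hj : IsStrict m n (rowWord m n lam.transpose (card_transpose hd) hl) j) :
    dividedE k m n (rowWord m n lam.transpose (card_transpose hd) hl) j v =
      ((Zw k (m + n) d).repr
          (dividedE k m n (rowWord m n lam.transpose (card_transpose hd) hl) j v)
          (rowWord m n lam.transpose (card_transpose hd) hl) /
        (Zw k (m + n) d).repr (canonicalTensor k m n lam hd hl)
          (rowWord m n lam.transpose (card_transpose hd) hl)) •
        canonicalTensor k m n lam hd hl := by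
  set c := rowWord m n lam.transpose (card_transpose hd) hl with hc
  rw [← sub_eq_zero]
  refine eq_zero_of_support hk hl (Submodule.sub_mem _
    (apply_mem_colAlternating (schurE k m n c j hj) hv)
    (Submodule.smul_mem _ _ (canonicalTensor_mem hl))) (c := c) (fun r => le_rfl) ?_ ?_
  · intro s hs
    by_contra hτ
    refine hs ?_
    rw [map_sub, Finsupp.sub_apply,
      repr_dividedE_eq_zero k m n fun τ e => absurd ⟨τ, e⟩ hτ, map_smul, Finsupp.smul_apply,
      not_not.1 (mt (exists_comp_of_repr_canonicalTensor hl) hτ), smul_zero, sub_zero]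
  · intro _
    rw [map_sub, Finsupp.sub_apply, map_smul, Finsupp.smul_apply, smul_eq_mul,
      div_mul_cancel₀ _ (repr_canonicalTensor_ne_zero hl), sub_self]

theorem dividedE_canonicalTensor (hk : (2 : k) ≠ 0) (hl : lam.transpose.colLen 0 ≤ m)
    {i j : Fin d → Fin (m + n)} (hij : IsStrict m n i j) (hle : i ≤ j) (hne : i ≠ j) :
    dividedE k m n i j (canonicalTensor k m n lam hd hl) = 0 := by
  set c := rowWord m n lam.transpose (card_transpose hd) hl with hc
  by_cases hj : ∃ τ : Equiv.Perm (Fin d), j ∘ τ = c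
  · obtain ⟨τ, hτ⟩ := hj
    -- After rearranging j into the row word, the image is supported on rearrangements of i∘τ, which
    -- is bounded by the row word and different from it.
    refine eq_zero_of_support hk hl
      (apply_mem_colAlternating (schurE k m n i j hij) (canonicalTensor_mem hl))
      (c := i ∘ τ) ?_ ?_ ?_
    · intro r
      have h1 : i (τ r) ≤ j (τ r) := hle (τ r)
      rw [show j (τ r) = c r from congrFun hτ r] at h1
      exact h1
    · intro s hs
      by_contra hno
      refine hs (repr_dividedE_eq_zero k m n fun τ' e => absurd ⟨τ⁻¹ * τ', ?_⟩ hno)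
      rw [← e]
      funext r
      simp
    · intro e
      refine absurd ?_ hne
      exact τ.surjective.injective_comp_right (e.trans hτ.symm)
  · refine (Zw k (m + n) d).repr.injective ?_
    rw [map_zero]
    ext s
    refine repr_dividedE_eq_zero k m n fun τ _ => ?_
    by_contra h1
    obtain ⟨τ', h2⟩ := exists_comp_of_repr_canonicalTensor hl h1
    refine hj ⟨τ * τ'⁻¹, ?_⟩
    funext r
    simpa using (congrFun h2 (τ'⁻¹ r)).symm

/-! ### The action of N(m|n,d) on the Schur supermodule -/

theorem schurE_mem_upperN {i j : Fin d → Fin (m + n)} (hij : IsStrict m n i j) (hle : i ≤ j)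
    (hne : i ≠ j) : schurE k m n i j hij ∈ upperN k m n d := by
  refine Submodule.subset_span ⟨i, j, hij, fun σ => Pi.toLex_strictMono ?_, rfl⟩
  refine lt_of_le_of_ne (fun r => hle (σ r)) fun e => hne ?_
  exact σ.surjective.injective_comp_right e

theorem le_of_toLex_lt {i j : Fin d → Fin (m + n)}
    (hij : ∀ σ : Equiv.Perm (Fin d), toLex (i ∘ σ) < toLex (j ∘ σ)) : i ≤ j ∧ i ≠ j := by
  refine ⟨fun r => ?_, fun e => ?_⟩
  · have hd : 0 < d := r.pos
    -- Moving position r to the front makes the lexicographic inequality compare i r and j r first.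
    obtain ⟨x, h1, h2⟩ := hij (Equiv.swap r ⟨0, hd⟩)
    rcases Nat.eq_zero_or_pos (x : ℕ) with h0 | h0
    · have hx : x = ⟨0, hd⟩ := Fin.ext h0
      subst hx
      simpa using h2.le
    · have h3 := h1 ⟨0, hd⟩ h0
      simpa using h3.le
  · have := hij 1
    rw [e] at this
    exact lt_irrefl _ this

theorem mkQ_smul {mu : YoungDiagram} {h : mu.card = d} (a : k) (w : TensorPow k (m + n) d) :
    (symKer k m n mu h).mkQ (a • w) = a • (symKer k m n mu h).mkQ w := rfl

theorem exists_lift (v : schurSupermodule k m n lam.transpose (card_transpose hd)) :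
    ∃ w ∈ colAlternating k m n lam.transpose (card_transpose hd),
      v.1 = (symKer k m n lam.transpose (card_transpose hd)).mkQ w := by
  obtain ⟨_, ⟨w, rfl⟩⟩ := v
  exact ⟨_, superPerm_sigmaPerm_mem w.2, rfl⟩

theorem canonicalElement_ne_zero (hl : lam.transpose.colLen 0 ≤ m) :
    canonicalElement k m n lam hd hl ≠ 0 := by
  intro h0
  have h1 := congrArg Subtype.val h0
  rw [mkQ_canonicalTensor] at h1
  have h2 := (Submodule.Quotient.mk_eq_zero _).1 h1
  have h3 := rowCoeff_eq_zero (parity_rowWord (n := n) (h := card_transpose hd) hl) h2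
  rw [rowCoeff_rowWord] at h3
  exact repr_canonicalTensor_ne_zero hl h3

set_option synthInstance.maxHeartbeats 200000 in
/-- An element of the Schur supermodule is either a multiple of the canonical element, or some
element of `N(m|n,d)` maps it to a nonzero multiple of the canonical element. -/
theorem mem_span_or_exists_smul (hk : (2 : k) ≠ 0) (hl : lam.transpose.colLen 0 ≤ m)
    (v : schurSupermodule k m n lam.transpose (card_transpose hd)) :
    (∃ a : k, v = a • canonicalElement k m n lam hd hl) ∨
      ∃ x ∈ upperN k m n d, ∃ a : k, a ≠ 0 ∧ x • v = a • canonicalElement k m n lam hd hl := by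
  set c := rowWord m n lam.transpose (card_transpose hd) hl with hc
  set w₀ := canonicalTensor k m n lam hd hl with hw₀
  obtain ⟨w, hw, hvw⟩ := exists_lift (hd := hd) v
  by_cases hex : ∃ j, IsStrict m n c j ∧ c ≤ j ∧ c ≠ j ∧
      (Zw k (m + n) d).repr (dividedE k m n c j w) c ≠ 0
  · right
    obtain ⟨j, h1, h2, h3, h4⟩ := hex
    refine ⟨schurE k m n c j h1, schurE_mem_upperN h1 h2 h3, _,
      div_ne_zero h4 (repr_canonicalTensor_ne_zero (n := n) (hd := hd) hl), Subtype.ext ?_⟩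
    change schurE k m n c j h1 • v.1 = _ • (canonicalElement k m n lam hd hl).1
    rw [hvw, mkQ_canonicalTensor (hd := hd) hl]
    change (symKer k m n lam.transpose (card_transpose hd)).mkQ (dividedE k m n c j w) = _
    exact (congrArg _ (dividedE_rowWord_eq_smul (hd := hd) hk hl hw h1)).trans
      (mkQ_smul (h := card_transpose hd) _ _)
  · left
    -- This scalar makes the coordinate of w − a w₀ at c vanish.
    set a := (Zw k (m + n) d).repr w c / (Zw k (m + n) d).repr w₀ c with ha
    refine ⟨a, Subtype.ext ?_⟩
    change v.1 = a • (canonicalElement k m n lam hd hl).1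
    rw [hvw, mkQ_canonicalTensor (hd := hd) hl]
    rw [← mkQ_smul (h := card_transpose hd), Submodule.mkQ_apply, Submodule.mkQ_apply,
      Submodule.Quotient.eq]
    by_contra hnot
    obtain ⟨j, h1, h2, h3⟩ := exists_ge_rowWord (h := card_transpose hd) hk hl
      (Submodule.sub_mem _ hw (Submodule.smul_mem _ a (canonicalTensor_mem (hd := hd) hl))) hnot
    rcases eq_or_ne c j with h4 | h4
    · subst h4
      -- At c, the operator E^{(c,c)} sees only the coordinate at c, which is zero by the choice of
      -- a.
      refine h3 (repr_dividedE_eq_zero k m n fun τ e => ?_)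
      rw [e, map_sub, map_smul, Finsupp.sub_apply, Finsupp.smul_apply, smul_eq_mul,
        div_mul_cancel₀ _ (repr_canonicalTensor_ne_zero (hd := hd) hl), sub_self]
    · refine hex ⟨j, h1, h2, h4, ?_⟩
      rwa [map_sub, map_smul, dividedE_canonicalTensor (hd := hd) hk hl h1 h2 h4, smul_zero,
        sub_zero] at h3

set_option synthInstance.maxHeartbeats 200000 in
theorem upperN_smul_canonicalElement (hk : (2 : k) ≠ 0) (hl : lam.transpose.colLen 0 ≤ m)
    {x : schurAlgebra k m n d} (hx : x ∈ upperN k m n d) :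
    x • canonicalElement k m n lam hd hl = 0 := by
  refine Submodule.span_induction ?_ (zero_smul _ _) ?_ ?_ hx
  · rintro _ ⟨i, j, hij, hlt, rfl⟩
    obtain ⟨h1, h2⟩ := le_of_toLex_lt hlt
    refine Subtype.ext ?_
    change (symKer k m n lam.transpose (card_transpose hd)).mkQ
      (dividedE k m n i j (canonicalTensor k m n lam hd hl)) = 0
    rw [dividedE_canonicalTensor hk hl hij h1 h2, map_zero]
  · intro x y _ _ hx hy
    rw [add_smul, hx, hy, add_zero]
  · intro a x _ hx
    rw [smul_assoc, hx, smul_zero]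

theorem canonicalElement_mem (hk : (2 : k) ≠ 0) (hl : lam.transpose.colLen 0 ≤ m)
    (W : Submodule k (schurSupermodule k m n lam.transpose (card_transpose hd)))
    (hW : IsNSubmodule (upperN k m n d) W) (hne : W ≠ ⊥) :
    canonicalElement k m n lam hd hl ∈ W := by
  obtain ⟨v, hv, hv0⟩ := W.ne_bot_iff.1 hne
  rcases mem_span_or_exists_smul hk hl v with ⟨a, ha⟩ | ⟨x, hx, a, ha, hxa⟩
  · have ha0 : a ≠ 0 := by
      rintro rfl
      exact hv0 (by rw [ha, zero_smul])
    rw [ha] at hv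
    exact (Submodule.smul_mem_iff W ha0).1 hv
  · have h1 := hW x hx v hv
    rw [hxa] at h1
    exact (Submodule.smul_mem_iff W ha).1 h1

end

end SchurSuper

end

theorem mainTheorem4 {k : Type*} [Field k] (hk : (2 : k) ≠ 0) (m n d : ℕ) (lam : YoungDiagram)
    (hd : lam.card = d) (hlam : lam.transpose.colLen 0 ≤ m) :
    (∀ W : Submodule k
        (SchurSuper.schurSupermodule k m n lam.transpose (SchurSuper.card_transpose hd)),
      SchurSuper.IsNSubmodule (SchurSuper.upperN k m n d) W → W ≠ ⊥ →
        SchurSuper.canonicalElement k m n lam hd hlam ∈ W) ∧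
    SchurSuper.nInvariants
        (V := SchurSuper.schurSupermodule k m n lam.transpose (SchurSuper.card_transpose hd))
        (SchurSuper.upperN k m n d) =
      Submodule.span k {SchurSuper.canonicalElement k m n lam hd hlam} ∧
    SchurSuper.IsNIndecomposable
      (V := SchurSuper.schurSupermodule k m n lam.transpose (SchurSuper.card_transpose hd))
      (SchurSuper.upperN k m n d) := by
  have hmem := SchurSuper.canonicalElement_mem (n := n) (hd := hd) hk hlam
  have hne := SchurSuper.canonicalElement_ne_zero (k := k) (n := n) (hd := hd) hlam
  refine ⟨hmem, ?_, ⟨_, _, hne⟩, ?_⟩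
  · refine le_antisymm (fun v hv => ?_) ?_
    · rcases SchurSuper.mem_span_or_exists_smul hk hlam v with ⟨a, ha⟩ | ⟨x, hx, a, ha, hxa⟩
      · exact Submodule.mem_span_singleton.2 ⟨a, ha.symm⟩
      · rw [hv x hx] at hxa
        exact absurd hxa.symm (smul_ne_zero ha hne)
    · rw [Submodule.span_singleton_le_iff_mem]
      exact fun x hx => SchurSuper.upperN_smul_canonicalElement hk hlam hx
  · intro W₁ W₂ h₁ h₂ hcompl
    by_contra hcon
    rw [not_or] at hcon
    exact hne (Submodule.disjoint_def.1 hcompl.disjoint _ (hmem W₁ h₁ hcon.1)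
      (hmem W₂ h₂ hcon.2))
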